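/- A word automaton is a nondeterministic finite automaton reading finite words over a finite alphabet $\Sigma$. The convolution of $x,y\in\Sigma^\star$ is the word over $(\Sigma\cup\{\Diamond\})^2$ obtained by reading $x$ and $y$ in parallel, where the shorter word is padded at its end with the new symbol $\Diamond$. A pair consisting of a word automaton $\mathcal M$ over $\Sigma$ and a word automaton $\mathcal M_\le$ over $(\Sigma\cup\{\Diamond\})^2$ presents the structure $(A;\le)$ whose domain $A\subseteq\Sigma^\star$ is the language of $\mathcal M$ and in which, for $x,y\in A$, $x\le y$ holds if and only if $\mathcal M_\le$ accepts the convolution of $x$ and $y$. A linear order is called an ordinal if it is well-founded; it is an automatic ordinal if it is presented by such a pair. Theorem. The isomorphism problem for automatic ordinals is decidable: there is an algorithm which, given two pairs $(\mathcal M,\mathcal M_\le)$ and $(\mathcal N,\mathcal N_\le)$ of word automata, each pair over some finite alphabet, decides whether the two presented structures are both ordinals and are isomorphic. In particular, the algorithm decides whether two given automatic ordinals are isomorphic. -/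

import Mathlib

/-- A finite description of a nondeterministic word automaton. The states are the numbers below
`numStates`, `start` is the initial state, `trans` lists the transition table as triples
(state, letter, state), and `accept` lists the accepting states. Letters are written in `β`. -/
structure WordAutomaton (β : Type) where
  numStates : ℕ
  start : ℕ
  trans : List (ℕ × β × ℕ)
  accept : List ℕ

namespace WordAutomaton

def equivProd (β : Type) :
    WordAutomaton β ≃ ℕ × ℕ × List (ℕ × β × ℕ) × List ℕ where
  toFun A := (A.numStates, A.start, A.trans, A.accept)
  invFun p := ⟨p.1, p.2.1, p.2.2.1, p.2.2.2⟩
  left_inv _ := rfl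
  right_inv _ := rfl

instance instPrimcodable (β : Type) [Primcodable β] : Primcodable (WordAutomaton β) :=
  Primcodable.ofEquiv _ (equivProd β)

/-- The automaton over the alphabet `α` that is described by `A`, when the letter `a` is written
as `code a`. Entries of the lists that mention other letters or numbers that are not states
have no effect, and an automaton whose `start` is not a state accepts nothing. -/
def toNFA {α β : Type} (A : WordAutomaton β) (code : α → β) : NFA α (Fin A.numStates) where
  step q a := {r | ((q : ℕ), code a, (r : ℕ)) ∈ A.trans}
  start := {q | (q : ℕ) = A.start}
  accept := {q | (q : ℕ) ∈ A.accept}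

end WordAutomaton

/-- The convolution of two words: they are read in parallel, and the shorter one is padded at its
end with the new symbol `none`. -/
def wordConvolution {α : Type} (x y : List α) : List (Option α × Option α) :=
  List.zipWithAll Prod.mk x y

/-- A finite description of a word-automatic structure with one binary relation: the size of the
alphabet, an automaton for the domain, and an automaton that reads convolutions of pairs of
words, for the relation. -/
structure AutomaticPresentation where
  alphabetSize : ℕ
  domain : WordAutomaton ℕ
  relation : WordAutomaton (Option ℕ × Option ℕ)

namespace AutomaticPresentation

def equivProd :
    AutomaticPresentation ≃ ℕ × WordAutomaton ℕ × WordAutomaton (Option ℕ × Option ℕ) where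
  toFun P := (P.alphabetSize, P.domain, P.relation)
  invFun p := ⟨p.1, p.2.1, p.2.2⟩
  left_inv _ := rfl
  right_inv _ := rfl

instance instPrimcodable : Primcodable AutomaticPresentation :=
  Primcodable.ofEquiv _ equivProd

/-- The regular language over the alphabet `{0, …, k - 1}` accepted by the domain automaton. -/
def domainLanguage (P : AutomaticPresentation) : Language (Fin P.alphabetSize) :=
  (P.domain.toNFA Fin.val).accepts

/-- The regular language of convolutions accepted by the automaton of the relation. -/
def relationLanguage (P : AutomaticPresentation) :
    Language (Option (Fin P.alphabetSize) × Option (Fin P.alphabetSize)) :=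
  (P.relation.toNFA fun a => (a.1.map Fin.val, a.2.map Fin.val)).accepts

/-- The domain of the presented structure. -/
def Carrier (P : AutomaticPresentation) : Type :=
  {w : List (Fin P.alphabetSize) // w ∈ P.domainLanguage}

/-- The binary relation of the presented structure. -/
def Le (P : AutomaticPresentation) (x y : P.Carrier) : Prop :=
  wordConvolution x.1 y.1 ∈ P.relationLanguage

/-- The presented structure is an ordinal: its relation is a (reflexive) linear order which is
well-founded. -/
def IsOrdinal (P : AutomaticPresentation) : Prop :=
  IsLinearOrder P.Carrier P.Le ∧ WellFounded fun x y : P.Carrier => P.Le x y ∧ x ≠ y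

/-- The presented structures are isomorphic. -/
def Isomorphic (P Q : AutomaticPresentation) : Prop :=
  Nonempty (P.Le ≃r Q.Le)

end AutomaticPresentation

/-!
The derivative of an ordinal consists of the points `ω * β`, and its `j`-th iterated derivative of
the points `ω ^ j * β`. The numbers of points of the `j`-th derivative above the next one reflect
the coefficients in the Cantor normal form: an ordinal below `ω ^ ω` is determined by finitely many
of them, together with whether it is empty.

Automatic ordinals are below `ω ^ ω` by Delhommé's argument. If an initial segment of large rank is
split according to a prefix of its words, one of the parts still has large rank; there are only
boundedly many Myhill–Nerode classes for such parts, and the class determines the rank. So all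
derivatives beyond a bound computed from the automata have at most one point. Conversely, a linear
order is well-founded as soon as some iterated derivative has at most one point and, at each earlier
stage, every point is at finite distance above a point of the derivative.

All these conditions are expressed with Boolean operations and the quantifiers `∃` and `∃^∞` over
words. A regular relation comes with a bound on its number of Myhill–Nerode classes, and pumping
turns it into a bound on the length of witnesses for both quantifiers, so the conditions are
primitive recursive. A derivative is again regular, and its minimal automaton can be computed from
its membership test and its number of classes, which allows the derivatives to be iterated.
-/

/-! ### Relations with finitely many Myhill–Nerode classes -/

/-- Replace everything after position `t` in the words that are at least that long: this continues
the synchronous reading of the words `x` with `y` once the first `t` columns have been read. -/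
def splice {ι α : Type*} (t : ℕ) (x y : ι → List α) : ι → List α :=
  fun i => if t ≤ (x i).length then (x i).take t ++ y i else x i

section Splice

variable {ι α : Type*}

theorem splice_eq_take_append (t : ℕ) (x y : ι → List α) (i : ι) :
    splice t x y i = (x i).take t ++ if t ≤ (x i).length then y i else [] := by
  by_cases h : t ≤ (x i).length
  · simp [splice, h]
  · simp [splice, h, List.take_of_length_le (not_le.1 h).le]

theorem splice_update [DecidableEq ι] (t : ℕ) (x y : ι → List α) (i : ι) (v w : List α) :
    splice t (Function.update x i v) (Function.update y i w) =
      Function.update (splice t x y) i (if t ≤ v.length then v.take t ++ w else v) := by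
  funext j
  by_cases h : j = i
  · subst h; simp [splice]
  · simp [splice, h]

theorem splice_update_drop [DecidableEq ι] (t : ℕ) (x y : ι → List α) (i : ι) (w : List α) :
    splice t (Function.update x i w) (Function.update y i (w.drop t)) =
      Function.update (splice t x y) i w := by
  simp [splice_update]

end Splice

/-- The relation `R` has at most `N` Myhill–Nerode classes when its words are read synchronously:
the class `f t x` of the first `t` columns of `x` determines which continuations satisfy `R`.
This is regularity of `R` with a bound on the number of states, independently of an alphabet. -/
def HasIndex {ι α : Type*} (N : ℕ) (R : (ι → List α) → Prop) : Prop :=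
  ∃ f : ℕ → (ι → List α) → Fin N,
    ∀ t x t' x', f t x = f t' x' → ∀ y, R (splice t x y) ↔ R (splice t' x' y)

namespace HasIndex

variable {ι κ α : Type*} {N M : ℕ} {R Q : (ι → List α) → Prop}

theorem of_card_le {S : Type*} [Finite S] (hS : Nat.card S ≤ N) (f : ℕ → (ι → List α) → S)
    (hf : ∀ t x t' x', f t x = f t' x' → ∀ y, R (splice t x y) ↔ R (splice t' x' y)) :
    HasIndex N R := by
  have e : S ↪ Fin N := (Finite.equivFin S).toEmbedding.trans (Fin.castLEEmb hS)
  exact ⟨fun t x => e (f t x), fun _ _ _ _ h => hf _ _ _ _ (e.injective h)⟩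

theorem not (h : HasIndex N R) : HasIndex N fun x => ¬ R x :=
  let ⟨f, hf⟩ := h
  ⟨f, fun _ _ _ _ e y => not_congr (hf _ _ _ _ e y)⟩

theorem and (h : HasIndex N R) (h' : HasIndex M Q) : HasIndex (N * M) fun x => R x ∧ Q x := by
  obtain ⟨f, hf⟩ := h
  obtain ⟨g, hg⟩ := h'
  refine of_card_le (S := Fin N × Fin M) (by simp) (fun t x => (f t x, g t x))
    fun _ _ _ _ e y => ?_
  rw [Prod.mk.injEq] at e
  exact and_congr (hf _ _ _ _ e.1 y) (hg _ _ _ _ e.2 y)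

theorem iff (h : HasIndex N R) (h' : HasIndex M Q) : HasIndex (N * M) fun x => R x ↔ Q x := by
  obtain ⟨f, hf⟩ := h
  obtain ⟨g, hg⟩ := h'
  refine of_card_le (S := Fin N × Fin M) (by simp) (fun t x => (f t x, g t x))
    fun _ _ _ _ e y => ?_
  rw [Prod.mk.injEq] at e
  exact iff_congr (hf _ _ _ _ e.1 y) (hg _ _ _ _ e.2 y)

theorem reindex (h : HasIndex N R) (σ : ι → κ) :
    HasIndex N fun x : κ → List α => R fun i => x (σ i) :=
  let ⟨f, hf⟩ := h
  ⟨fun t x => f t fun i => x (σ i), fun _ _ _ _ e y => hf _ _ _ _ e fun i => y (σ i)⟩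

theorem exists_splice_iff_splice (h : HasIndex N R) (L : ℕ) (x : ι → List α) :
    ∃ a b, L ≤ a ∧ a < b ∧ b ≤ L + N ∧ ∀ y, R (splice a x y) ↔ R (splice b x y) := by
  obtain ⟨f, hf⟩ := h
  obtain ⟨a, b, hab, e⟩ := Fintype.exists_ne_map_eq_of_card_lt
    (fun k : Fin (N + 1) => f (L + k) x) (by simp)
  rcases lt_or_gt_of_ne hab with hlt | hlt
  · exact ⟨L + a, L + b, by omega, by simpa using hlt, by omega, hf _ _ _ _ e⟩
  · exact ⟨L + b, L + a, by omega, by simpa using hlt, by omega, hf _ _ _ _ e.symm⟩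

theorem exists_take_append_drop (h : HasIndex N R) (L : ℕ) {x : ι → List α} (hx : R x) :
    ∃ a b, L ≤ a ∧ a < b ∧ b ≤ L + N ∧ R fun i => (x i).take a ++ (x i).drop b := by
  obtain ⟨a, b, hL, hab, hb, H⟩ := h.exists_splice_iff_splice L x
  refine ⟨a, b, hL, hab, hb, ?_⟩
  have h_restore : splice b x (fun i => (x i).drop b) = x := by funext i; simp [splice]
  have h_cut : splice a x (fun i => (x i).drop b) = fun i => (x i).take a ++ (x i).drop b := by
    funext i
    by_cases hi : a ≤ (x i).length
    · simp [splice, hi]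
    · have hxa : (x i).length ≤ a := by omega
      simp [splice, hi, List.take_of_length_le hxa, List.drop_of_length_le (hxa.trans hab.le)]
  rwa [← h_cut, H, h_restore]

theorem exists_short [Finite ι] (h : HasIndex N R) (L : ℕ) {x : ι → List α} (hx : R x) :
    ∃ x', R x' ∧ (∀ i, (x i).length ≤ L → x' i = x i) ∧ ∀ i, (x' i).length ≤ L + N := by
  have := Fintype.ofFinite ι
  induction hs : ∑ i, (x i).length using Nat.strong_induction_on generalizing x with
  | _ s ih =>
    by_cases hshort : ∀ i, (x i).length ≤ L + N
    · exact ⟨x, hx, fun _ _ => rfl, hshort⟩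
    push Not at hshort
    obtain ⟨i, hi⟩ := hshort
    obtain ⟨a, b, hL, hab, hb, hR⟩ := h.exists_take_append_drop L hx
    have hle : ∀ j, ((x j).take a ++ (x j).drop b).length ≤ (x j).length := by
      intro j; simp; omega
    obtain ⟨x', hx', hkeep, hlen⟩ := ih _ (by
      rw [← hs]
      exact Finset.sum_lt_sum (fun j _ => hle j) ⟨i, Finset.mem_univ _, by simp; omega⟩) hR rfl
    refine ⟨x', hx', fun j hj => ?_, hlen⟩
    rw [hkeep j ((hle j).trans hj), List.take_of_length_le (hj.trans hL),
      List.drop_of_length_le (by omega), List.append_nil]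

variable [DecidableEq ι]

theorem exists_update (h : HasIndex N R) (i : ι) :
    HasIndex (2 ^ N) fun x => ∃ w, R (Function.update x i w) := by
  obtain ⟨f, hf⟩ := h
  have transfer : ∀ t x t' x', (Set.range fun w => f t (Function.update x i w)) =
      (Set.range fun w => f t' (Function.update x' i w)) →
      ∀ y, (∃ w, R (Function.update (splice t x y) i w)) →
        ∃ w, R (Function.update (splice t' x' y) i w) := by
    rintro t x t' x' e y ⟨w, hw⟩
    obtain ⟨q, hq⟩ : f t (Function.update x i w) ∈
        Set.range fun w => f t' (Function.update x' i w) := e ▸ Set.mem_range_self w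
    rw [← splice_update_drop, ← hf _ _ _ _ hq, splice_update] at hw
    exact ⟨_, hw⟩
  exact of_card_le (S := Set (Fin N)) (by simp)
    (fun t x => Set.range fun w => f t (Function.update x i w))
    fun _ _ _ _ e y => ⟨transfer _ _ _ _ e y, transfer _ _ _ _ e.symm y⟩

theorem unbounded_update (h : HasIndex N R) (i : ι) :
    HasIndex (2 ^ N) fun x => ∀ n, ∃ w : List α, n ≤ w.length ∧ R (Function.update x i w) := by
  obtain ⟨f, hf⟩ := h
  let g : ℕ → (ι → List α) → Set (Fin N) :=
    fun t x => {s | ∃ w : List α, t ≤ w.length ∧ f t (Function.update x i w) = s}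
  have transfer : ∀ t x t' x', g t x = g t' x' →
      ∀ y, (∀ n, ∃ w : List α, n ≤ w.length ∧ R (Function.update (splice t x y) i w)) →
        ∀ n, ∃ w : List α, n ≤ w.length ∧ R (Function.update (splice t' x' y) i w) := by
    intro t x t' x' e y H n
    obtain ⟨w, hl, hw⟩ := H (n + t)
    obtain ⟨q, hql, hq⟩ : f t (Function.update x i w) ∈ g t' x' := e ▸ ⟨w, by omega, rfl⟩
    rw [← splice_update_drop, ← hf _ _ _ _ hq, splice_update, if_pos hql] at hw
    exact ⟨_, by simp; omega, hw⟩
  exact of_card_le (by simp) g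
    fun _ _ _ _ e y => ⟨transfer _ _ _ _ e y, transfer _ _ _ _ e.symm y⟩

theorem exists_short_update [Finite ι] (h : HasIndex N R) {L : ℕ} {x : ι → List α} {i : ι}
    (hL : ∀ j, j ≠ i → (x j).length ≤ L) {w : List α} (hw : R (Function.update x i w)) :
    ∃ w' : List α, w'.length ≤ L + N ∧ R (Function.update x i w') := by
  obtain ⟨x', hR, hkeep, hlen⟩ := h.exists_short L hw
  refine ⟨x' i, hlen i, ?_⟩
  have hx' : x' = Function.update x i (x' i) := Function.eq_update_iff.2
    ⟨rfl, fun j hj => by simpa [hj] using hkeep j (by simpa [hj] using hL j hj)⟩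
  rwa [← hx']

theorem exists_longer_update (h : HasIndex N R) {L : ℕ} {x : ι → List α} {i : ι}
    (hL : ∀ j, j ≠ i → (x j).length ≤ L) {w : List α} (hl : L + N < w.length)
    (hw : R (Function.update x i w)) :
    ∃ w' : List α, w.length < w'.length ∧ R (Function.update x i w') := by
  obtain ⟨a, b, hLa, hab, hb, H⟩ := h.exists_splice_iff_splice L (Function.update x i w)
  have splice_eq : ∀ c v, L ≤ c → c ≤ w.length →
      splice c (Function.update x i w) (Function.update (fun _ => []) i v) =
        Function.update x i (w.take c ++ v) := by
    intro c v hc hcw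
    rw [splice_update, if_pos hcw]
    funext j
    by_cases hj : j = i
    · subst hj; simp
    · simp [splice, hj, List.take_of_length_le ((hL j hj).trans hc)]
  refine ⟨w.take b ++ w.drop a, by simp; omega, ?_⟩
  rw [← splice_eq b _ (by omega) (by omega), ← H, splice_eq a _ hLa (by omega)]
  simpa using hw

theorem exists_moderate_update (h : HasIndex N R) {L : ℕ} {x : ι → List α} {i : ι}
    (hL : ∀ j, j ≠ i → (x j).length ≤ L) {w : List α} (hl : L + N < w.length)
    (hw : R (Function.update x i w)) :
    ∃ w' : List α, L + N < w'.length ∧ w'.length ≤ L + 2 * N ∧ R (Function.update x i w') := by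
  induction hs : w.length using Nat.strong_induction_on generalizing w with
  | _ s ih =>
    by_cases hlong : w.length ≤ L + 2 * N
    · exact ⟨w, hl, hlong, hw⟩
    obtain ⟨a, b, hLa, hab, hb, hR⟩ := h.exists_take_append_drop L hw
    refine ih (w.take a ++ w.drop b).length (by simp; omega) (by simp; omega) ?_ rfl
    convert hR using 1
    funext j
    by_cases hj : j = i
    · subst hj; simp
    · have hxj := hL j hj
      simp [hj, List.take_of_length_le (hxj.trans hLa),
        List.drop_of_length_le (show (x j).length ≤ b by omega)]

theorem unbounded_update_iff (h : HasIndex N R) {L : ℕ} {x : ι → List α} {i : ι}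
    (hL : ∀ j, j ≠ i → (x j).length ≤ L) :
    (∀ n, ∃ w : List α, n ≤ w.length ∧ R (Function.update x i w)) ↔
      ∃ w : List α, L + N < w.length ∧ w.length ≤ L + 2 * N ∧ R (Function.update x i w) := by
  constructor
  · intro H
    obtain ⟨w, hl, hw⟩ := H (L + N + 1)
    exact h.exists_moderate_update hL hl hw
  · rintro ⟨w, hl, -, hw⟩ n
    induction n with
    | zero => exact ⟨w, by omega, hw⟩
    | succ n ih =>
      obtain ⟨v, hn, hv⟩ := ih
      by_cases hv' : L + N < v.length
      · obtain ⟨u, hu, hR⟩ := h.exists_longer_update hL hv' hv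
        exact ⟨u, by omega, hR⟩
      · obtain ⟨u, hu, hR⟩ := h.exists_longer_update hL hl hw
        exact ⟨u, by omega, hR⟩

end HasIndex

/-! ### Derivatives of linear orders -/

section Derivative

variable {V W : Type*}

/-- The points of `D` that are not preceded in `D` by another point at finite distance; for the
ordinal `α` these are the points `ω * β`, a copy of the least `γ` with `α ≤ ω * γ`. -/
def ordDeriv (lt : W → W → Prop) (D : Set W) : Set W :=
  {x | x ∈ D ∧ ∀ y ∈ D, lt y x → {z | z ∈ D ∧ lt y z ∧ lt z x}.Infinite}

/-- The iterated derivatives; for an ordinal, the points that are divisible by `ω ^ j`. -/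
def iterDeriv (lt : W → W → Prop) (D : Set W) : ℕ → Set W
  | 0 => D
  | j + 1 => ordDeriv lt (iterDeriv lt D j)

/-- The points of `D` that are larger than all points of the derivative. The number of these points
in the `j`-th iterated derivative of an ordinal is infinite or, up to an offset by one, the
coefficient of `ω ^ j` in the Cantor normal form. -/
def derivTail (lt : W → W → Prop) (D : Set W) : Set W :=
  {x | x ∈ D ∧ ∀ y ∈ ordDeriv lt D, lt y x}

/-- Every point of `D` is at finite distance above some point of the derivative. This first-order
consequence of well-foundedness lets well-foundedness climb back from the derivative to `D`. -/
def DerivCofinite (lt : W → W → Prop) (D : Set W) : Prop :=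
  ∀ x ∈ D, ∃ y ∈ ordDeriv lt D, ¬ lt x y ∧ {z | z ∈ D ∧ lt y z ∧ lt z x}.Finite

theorem ordDeriv_subset (lt : W → W → Prop) (D : Set W) : ordDeriv lt D ⊆ D := fun _ h => h.1

theorem iterDeriv_subset (lt : W → W → Prop) (D : Set W) (j : ℕ) : iterDeriv lt D j ⊆ D := by
  induction j with
  | zero => exact subset_rfl
  | succ j ih => exact (ordDeriv_subset _ _).trans ih

variable {ltV : V → V → Prop} {ltW : W → W → Prop} {D : Set W}

theorem finite_between_iff (e : ltV ↪r ltW) (hD : ∀ b ∈ D, ∀ a, ltW b (e a) → b ∈ Set.range e)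
    (x y : V) :
    {z | z ∈ D ∧ ltW (e y) z ∧ ltW z (e x)}.Finite ↔
      {z | z ∈ e ⁻¹' D ∧ ltV y z ∧ ltV z x}.Finite := by
  have h_image : {z | z ∈ D ∧ ltW (e y) z ∧ ltW z (e x)} =
      e '' {z | z ∈ e ⁻¹' D ∧ ltV y z ∧ ltV z x} := by
    ext z
    constructor
    · rintro ⟨hzD, hyz, hzx⟩
      obtain ⟨z, rfl⟩ := hD z hzD x hzx
      exact ⟨z, ⟨hzD, e.map_rel_iff.1 hyz, e.map_rel_iff.1 hzx⟩, rfl⟩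
    · rintro ⟨z, ⟨hzD, hyz, hzx⟩, rfl⟩
      exact ⟨hzD, e.map_rel_iff.2 hyz, e.map_rel_iff.2 hzx⟩
  rw [h_image, Set.finite_image_iff e.injective.injOn]

theorem preimage_ordDeriv (e : ltV ↪r ltW) (hD : ∀ b ∈ D, ∀ a, ltW b (e a) → b ∈ Set.range e) :
    e ⁻¹' ordDeriv ltW D = ordDeriv ltV (e ⁻¹' D) := by
  ext x
  refine and_congr_right fun _ => ⟨fun H y hy hyx => ?_, fun H y hy hyx => ?_⟩
  · exact (finite_between_iff e hD x y).not.1 (H _ hy (e.map_rel_iff.2 hyx))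
  · obtain ⟨y, rfl⟩ := hD y hy x hyx
    exact (finite_between_iff e hD x y).not.2 (H _ hy (e.map_rel_iff.1 hyx))

theorem preimage_iterDeriv (e : ltV ↪r ltW) (hD : ∀ b ∈ D, ∀ a, ltW b (e a) → b ∈ Set.range e)
    (j : ℕ) : e ⁻¹' iterDeriv ltW D j = iterDeriv ltV (e ⁻¹' D) j := by
  induction j with
  | zero => rfl
  | succ j ih =>
    simp only [iterDeriv]
    rw [preimage_ordDeriv e fun b hb => hD b (iterDeriv_subset _ _ _ hb), ih]

theorem preimage_derivTail (e : ltV ↪r ltW) (hD : D ⊆ Set.range e) :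
    e ⁻¹' derivTail ltW D = derivTail ltV (e ⁻¹' D) := by
  unfold derivTail
  rw [← preimage_ordDeriv e fun b hb _ _ => hD hb]
  ext x
  refine and_congr_right fun _ => ⟨fun H y hy => e.map_rel_iff.1 (H _ hy), fun H y hy => ?_⟩
  obtain ⟨y, rfl⟩ := hD (ordDeriv_subset _ _ hy)
  exact e.map_rel_iff.2 (H _ hy)

theorem derivCofinite_preimage_iff (e : ltV ↪r ltW) (hD : D ⊆ Set.range e) :
    DerivCofinite ltV (e ⁻¹' D) ↔ DerivCofinite ltW D := by
  have hD' : ∀ b ∈ D, ∀ a, ltW b (e a) → b ∈ Set.range e := fun b hb _ _ => hD hb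
  unfold DerivCofinite
  rw [← preimage_ordDeriv e hD']
  constructor
  · intro H x hx
    obtain ⟨x, rfl⟩ := hD hx
    obtain ⟨y, hy, hxy, hfin⟩ := H x hx
    exact ⟨e y, hy, e.map_rel_iff.not.2 hxy, (finite_between_iff e hD' x y).2 hfin⟩
  · intro H x hx
    obtain ⟨y, hy, hxy, hfin⟩ := H (e x) hx
    obtain ⟨y, rfl⟩ := hD (ordDeriv_subset _ _ hy)
    exact ⟨y, hy, e.map_rel_iff.not.1 hxy, (finite_between_iff e hD' x y).1 hfin⟩

end Derivative

section Large

variable {V W : Type*}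

/-- `X` contains `n` successive parts that satisfy `P`. -/
def HasPieces (lt : W → W → Prop) (P : Set W → Prop) : ℕ → Set W → Prop
  | 0, _ => True
  | n + 1, X => ∃ A B, A ⊆ X ∧ B ⊆ X ∧ (∀ a ∈ A, ∀ b ∈ B, lt a b) ∧ P A ∧ HasPieces lt P n B

/-- For a well-ordered `X` this says that the order type of `X` is at least `ω ^ j`. -/
def IsLarge (lt : W → W → Prop) : ℕ → Set W → Prop
  | 0, X => X.Nonempty
  | j + 1, X => ∀ n, HasPieces lt (IsLarge lt j) n X

variable {lt : W → W → Prop} {P : Set W → Prop} {X Y : Set W} {i j n : ℕ}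

theorem HasPieces.mono (h : HasPieces lt P n X) (hXY : X ⊆ Y) : HasPieces lt P n Y := by
  cases n with
  | zero => trivial
  | succ n =>
    obtain ⟨A, B, hA, hB, h⟩ := h
    exact ⟨A, B, hA.trans hXY, hB.trans hXY, h⟩

theorem HasPieces.union (hP : ∀ X Y, P (X ∪ Y) → P X ∨ P Y) :
    ∀ {a b : ℕ} {X Y Z : Set W}, Z ⊆ X ∪ Y → HasPieces lt P (a + b) Z →
      HasPieces lt P a X ∨ HasPieces lt P b Y
  | 0, _, _, _, _, _, _ => Or.inl trivial
  | _ + 1, 0, _, _, _, _, _ => Or.inr trivial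
  | a + 1, b + 1, X, Y, Z, hZ, h => by
    obtain ⟨A, B, hA, hB, hAB, hPA, hPB⟩ := h
    change HasPieces lt P (a + 1 + b) B at hPB
    have hBZ : B ⊆ (B ∩ X) ∪ (B ∩ Y) := by
      rw [← Set.inter_union_distrib_left, Set.inter_eq_left.2 (hB.trans hZ)]
    rw [← Set.inter_eq_left.2 (hA.trans hZ), Set.inter_union_distrib_left] at hPA
    rcases hP _ _ hPA with hPX | hPY
    · rw [Nat.add_right_comm] at hPB
      rcases HasPieces.union hP (a := a) (b := b + 1) hBZ hPB with h' | h'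
      · exact Or.inl ⟨_, _, Set.inter_subset_right, Set.inter_subset_right,
          fun x hx y hy => hAB x hx.1 y hy.1, hPX, h'⟩
      · exact Or.inr (h'.mono Set.inter_subset_right)
    · rcases HasPieces.union hP (a := a + 1) (b := b) hBZ hPB with h' | h'
      · exact Or.inl (h'.mono Set.inter_subset_right)
      · exact Or.inr ⟨_, _, Set.inter_subset_right, Set.inter_subset_right,
          fun x hx y hy => hAB x hx.1 y hy.1, hPY, h'⟩

theorem HasPieces.image {ltV : V → V → Prop} {φ : V → W} {Q : Set V → Prop} {X : Set V}
    (hφ : ∀ a ∈ X, ∀ b ∈ X, ltV a b → lt (φ a) (φ b)) (hQP : ∀ A ⊆ X, Q A → P (φ '' A))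
    (h : HasPieces ltV Q n X) : HasPieces lt P n (φ '' X) := by
  induction n generalizing X with
  | zero => trivial
  | succ n ih =>
    obtain ⟨A, B, hA, hB, hAB, hQA, hn⟩ := h
    refine ⟨φ '' A, φ '' B, Set.image_mono hA, Set.image_mono hB, ?_, hQP A hA hQA,
      ih (fun a ha b hb => hφ a (hB ha) b (hB hb)) (fun C hC => hQP C (hC.trans hB)) hn⟩
    rintro _ ⟨a, ha, rfl⟩ _ ⟨b, hb, rfl⟩
    exact hφ a (hA ha) b (hB hb) (hAB a ha b hb)

namespace IsLarge

theorem mono (h : IsLarge lt j X) (hXY : X ⊆ Y) : IsLarge lt j Y := by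
  cases j with
  | zero => exact Set.Nonempty.mono hXY h
  | succ j => exact fun n => (h n).mono hXY

theorem of_succ (h : IsLarge lt (j + 1) X) : IsLarge lt j X := by
  obtain ⟨A, -, hA, -, -, hl, -⟩ := h 1
  exact hl.mono hA

theorem of_le (h : IsLarge lt j X) (hij : i ≤ j) : IsLarge lt i X := by
  induction hij with
  | refl => exact h
  | step _ ih => exact ih h.of_succ

theorem nonempty (h : IsLarge lt j X) : X.Nonempty := h.of_le (Nat.zero_le j)

theorem exists_bounded_subset (h : IsLarge lt (j + 1) X) :
    ∃ A ⊆ X, IsLarge lt j A ∧ ∃ b ∈ X, ∀ a ∈ A, lt a b := by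
  obtain ⟨A, B, hA, hB, hAB, hl, A', -, hA', -, -, hl', -⟩ := h 2
  obtain ⟨b, hb⟩ := hl'.nonempty
  exact ⟨A, hA, hl, b, hB (hA' hb), fun a ha => hAB a ha b (hA' hb)⟩

theorem union (h : IsLarge lt j (X ∪ Y)) : IsLarge lt j X ∨ IsLarge lt j Y := by
  induction j generalizing X Y with
  | zero => exact Set.union_nonempty.1 h
  | succ j ih =>
    by_contra! hc
    obtain ⟨hX, hY⟩ := hc
    simp only [IsLarge, not_forall] at hX hY
    obtain ⟨a, ha⟩ := hX
    obtain ⟨b, hb⟩ := hY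
    exact (HasPieces.union (fun _ _ => ih) subset_rfl (h (a + b))).elim ha hb

theorem exists_of_biUnion {κ : Type*} {s : Set κ} (hs : s.Finite) {F : κ → Set W}
    (h : IsLarge lt j (⋃ i ∈ s, F i)) : ∃ i ∈ s, IsLarge lt j (F i) := by
  induction s, hs using Set.Finite.induction_on with
  | empty => simpa using h.nonempty
  | @insert a s _ _ ih =>
    rw [Set.biUnion_insert] at h
    rcases h.union with h | h
    · exact ⟨a, Set.mem_insert _ _, h⟩
    · obtain ⟨i, hi, hl⟩ := ih h
      exact ⟨i, Set.mem_insert_of_mem _ hi, hl⟩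

theorem image {ltV : V → V → Prop} {φ : V → W} {X : Set V}
    (hφ : ∀ a ∈ X, ∀ b ∈ X, ltV a b → lt (φ a) (φ b)) (h : IsLarge ltV j X) :
    IsLarge lt j (φ '' X) := by
  induction j generalizing X with
  | zero => exact Set.Nonempty.image φ h
  | succ j ih =>
    exact fun n => (h n).image hφ fun A hA hl =>
      ih (fun a ha b hb => hφ a (hA ha) b (hA hb)) hl

end IsLarge

end Large

section WellOrder

variable {T : Type*} [LinearOrder T]

theorem derivCofinite_of_wellFoundedLT [WellFoundedLT T] (D : Set T) :
    DerivCofinite (· < ·) D := by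
  intro x hx
  have hne : {y | y ∈ D ∧ y ≤ x ∧ {z | z ∈ D ∧ y < z ∧ z < x}.Finite}.Nonempty :=
    ⟨x, hx, le_rfl, Set.finite_empty.subset fun _ hz => lt_asymm hz.2.1 hz.2.2⟩
  obtain ⟨y, ⟨hyD, hyx, hfin⟩, hmin⟩ := WellFounded.has_min (wellFounded_lt (α := T)) _ hne
  refine ⟨y, ⟨hyD, fun u hu huy hfin' => hmin u ⟨hu, huy.le.trans hyx, ?_⟩ huy⟩,
    not_lt.2 hyx, hfin⟩
  refine ((hfin'.union hfin).union (Set.finite_singleton y)).subset ?_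
  rintro z ⟨hz, huz, hzx⟩
  rcases lt_trichotomy z y with h | h | h
  · exact Or.inl (Or.inl ⟨hz, huz, h⟩)
  · exact Or.inr h
  · exact Or.inl (Or.inr ⟨hz, h, hzx⟩)

/-- Above the least point `m` of the derivative that is close to `X`, only finitely many points
of `D` precede a given point of `X`. -/
theorem exists_least_of_derivCofinite {D : Set T} (hD : DerivCofinite (· < ·) D)
    (h : ∀ X ⊆ ordDeriv (· < ·) D, X.Nonempty → ∃ m, IsLeast X m) {X : Set T} (hX : X ⊆ D)
    (hne : X.Nonempty) : ∃ m, IsLeast X m := by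
  let Y : Set T := {y | y ∈ ordDeriv (· < ·) D ∧
    ∃ x ∈ X, y ≤ x ∧ {z | z ∈ D ∧ y < z ∧ z < x}.Finite}
  have hY : ∀ x ∈ X, ∃ y ∈ Y, y ≤ x := by
    intro x hx
    obtain ⟨y, hy, hxy, hfin⟩ := hD x (hX hx)
    exact ⟨y, ⟨hy, x, hx, not_lt.1 hxy, hfin⟩, not_lt.1 hxy⟩
  obtain ⟨m, ⟨-, x, hx, -, hfin⟩, hmin⟩ := h Y (fun y hy => hy.1) <| by
    obtain ⟨x, hx⟩ := hne
    obtain ⟨y, hy, -⟩ := hY x hx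
    exact ⟨y, hy⟩
  have hfinX : (X ∩ Set.Iic x).Finite := by
    refine ((hfin.union (Set.finite_singleton m)).union (Set.finite_singleton x)).subset ?_
    rintro z ⟨hz, hzx⟩
    obtain ⟨y, hy, hyz⟩ := hY z hz
    rcases ((hmin hy).trans hyz).eq_or_lt with hmz | hmz
    · exact Or.inl (Or.inr hmz.symm)
    rcases (show z ≤ x from hzx).eq_or_lt with hzx | hzx
    · exact Or.inr hzx
    · exact Or.inl (Or.inl ⟨hX hz, hmz, hzx⟩)
  obtain ⟨u, hu, hmin'⟩ := Set.exists_min_image _ id hfinX ⟨x, hx, le_rfl⟩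
  refine ⟨u, hu.1, fun z hz => ?_⟩
  rcases le_total z x with hzx | hxz
  · exact hmin' z ⟨hz, hzx⟩
  · exact (show u ≤ x from hu.2).trans hxz

/-- The iterated derivatives of a linear order, inside the order itself. -/
abbrev ordLevel (T : Type*) [LT T] (j : ℕ) : Set T := iterDeriv (· < ·) Set.univ j

theorem wellFoundedLT_of_derivCofinite {J : ℕ}
    (h : ∀ j < J, DerivCofinite (· < ·) (ordLevel T j)) (hJ : (ordLevel T J).Subsingleton) :
    WellFoundedLT T := by
  have h_least : ∀ j ≤ J, ∀ X ⊆ ordLevel T j, X.Nonempty → ∃ m, IsLeast X m := by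
    intro j hj
    induction hj using Nat.decreasingInduction with
    | self =>
      rintro X hX ⟨x, hx⟩
      exact ⟨x, hx, fun y hy => (hJ (hX hx) (hX hy)).le⟩
    | of_succ j hj ih => exact fun _ hX hne => exists_least_of_derivCofinite (h j hj) ih hX hne
  refine ⟨WellFounded.wellFounded_iff_has_min.2 fun X hX => ?_⟩
  obtain ⟨m, hm, hmin⟩ := h_least 0 J.zero_le X (Set.subset_univ X) hX
  exact ⟨m, hm, fun x hx => not_lt.2 (hmin hx)⟩

theorem isLarge_Ico [WellFoundedLT T] {D : Set T} {j : ℕ} {x y : T}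
    (hy : y ∈ iterDeriv (· < ·) D j) (hx : x ∈ iterDeriv (· < ·) D j) (hyx : y < x) :
    IsLarge (· < ·) j (Set.Ico y x) := by
  induction j generalizing x y with
  | zero => exact ⟨y, le_rfl, hyx⟩
  | succ j ih =>
    intro n
    have hinf := hx.2 y hy.1 hyx
    have hy' := hy.1
    clear hy hyx
    induction n generalizing y with
    | zero => trivial
    | succ n ihn =>
      obtain ⟨z, ⟨hz, hyz, hzx⟩, hmin⟩ :=
        WellFounded.has_min (wellFounded_lt (α := T)) _ hinf.nonempty
      refine ⟨Set.Ico y z, Set.Ico z x, Set.Ico_subset_Ico_right hzx.le,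
        Set.Ico_subset_Ico_left hyz.le, fun a ha b hb => ha.2.trans_le hb.1,
        ih hy' hz hyz, ihn (fun hfin => hinf ?_) hz⟩
      refine (hfin.union (Set.finite_singleton z)).subset ?_
      rintro u ⟨hu, hyu, hux⟩
      rcases lt_trichotomy u z with h | h | h
      · exact absurd h (hmin u ⟨hu, hyu, hux⟩)
      · exact Or.inr h
      · exact Or.inl ⟨hu, h, hux⟩

end WellOrder

section Comparison

variable {A B : Type*} [LinearOrder A] [LinearOrder B] {J j : ℕ}

theorem mem_ordLevel_of_isBot {b : B} (hb : IsBot b) (j : ℕ) : b ∈ ordLevel B j := by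
  induction j with
  | zero => trivial
  | succ j ih => exact ⟨ih, fun y _ hy => absurd hy (not_lt.2 (hb y))⟩

theorem preimage_ordLevel (f : A ≤i B) (j : ℕ) : f ⁻¹' ordLevel B j = ordLevel A j :=
  preimage_iterDeriv f.toRelEmbedding (fun _ _ _ hb => f.mem_range_of_rel hb) j

theorem exists_last_ordLevel_ge [WellFoundedLT B] (hJ : (ordLevel B J).Subsingleton) {a b : B}
    (hab : a < b) :
    ∃ j < J, (∃ c ∈ ordLevel B j, b ≤ c) ∧ ∀ c ∈ ordLevel B (j + 1), c < b := by
  have h_not : ¬ ∃ c ∈ ordLevel B J, b ≤ c := by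
    rintro ⟨c, hc, hbc⟩
    obtain ⟨m, -, hm⟩ := WellFounded.has_min (wellFounded_lt (α := B)) Set.univ ⟨c, trivial⟩
    have hbot : IsBot m := fun c => not_lt.1 (hm c trivial)
    exact absurd (hbot a) (not_le.2 (hab.trans_le (hbc.trans
      (hJ hc (mem_ordLevel_of_isBot hbot J)).le)))
  by_contra! hcon
  have h_all : ∀ j ≤ J, ∃ c ∈ ordLevel B j, b ≤ c := by
    intro j
    induction j with
    | zero => exact fun _ => ⟨b, trivial, le_rfl⟩
    | succ j ih => exact fun hj => hcon j hj (ih (by omega))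
  exact h_not (h_all J le_rfl)

theorem image_derivTail_ordLevel (f : A <i B) (h : ∀ c ∈ ordLevel B (j + 1), c < f.top) :
    f '' derivTail (· < ·) (ordLevel A j) =
      derivTail (· < ·) (ordLevel B j) ∩ Set.Iio f.top := by
  have h_mem (i : ℕ) (a : A) : f a ∈ ordLevel B i ↔ a ∈ ordLevel A i := by
    rw [← preimage_ordLevel (f : A ≤i B)]; rfl
  ext b
  constructor
  · rintro ⟨a, ⟨ha, ha'⟩, rfl⟩
    refine ⟨⟨(h_mem j a).2 ha, fun z hz => ?_⟩, f.lt_top a⟩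
    obtain ⟨z, rfl⟩ := f.mem_range_of_rel_top (h z hz)
    exact f.map_rel_iff.2 (ha' z ((h_mem (j + 1) z).1 hz))
  · rintro ⟨⟨hb, hb'⟩, hbt⟩
    obtain ⟨a, rfl⟩ := f.mem_range_of_rel_top hbt
    exact ⟨a, ⟨(h_mem j a).1 hb, fun z hz =>
      f.map_rel_iff.1 (hb' _ ((h_mem (j + 1) z).2 hz))⟩, rfl⟩

theorem encard_derivTail_lt [WellFoundedLT B] (f : A <i B) {c : B} (hc : c ∈ ordLevel B j)
    (hfc : f.top ≤ c) (h : ∀ c ∈ ordLevel B (j + 1), c < f.top) :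
    (derivTail (· < ·) (ordLevel A j)).encard < (derivTail (· < ·) (ordLevel B j)).encard := by
  rw [← f.injective.encard_image, image_derivTail_ordLevel f h]
  have hc_tail : c ∈ derivTail (· < ·) (ordLevel B j) := ⟨hc, fun z hz => (h z hz).trans_le hfc⟩
  have hfinite : (derivTail (· < ·) (ordLevel B j) ∩ Set.Iio f.top).Finite := by
    obtain ⟨y, hy, -, hfin⟩ := derivCofinite_of_wellFoundedLT _ c hc
    exact hfin.subset fun z hz => ⟨hz.1.1, hz.1.2 y hy, lt_of_lt_of_le hz.2 hfc⟩
  exact hfinite.encard_lt_encard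
    ⟨Set.inter_subset_left, fun hsub => not_lt.2 hfc (hsub hc_tail).2⟩

theorem isEmpty_principalSeg [WellFoundedLT B] (hJ : (ordLevel B J).Subsingleton)
    (hne : Nonempty B → Nonempty A)
    (he : ∀ j < J, (derivTail (· < ·) (ordLevel A j)).encard =
      (derivTail (· < ·) (ordLevel B j)).encard) : IsEmpty (A <i B) := by
  refine ⟨fun f => ?_⟩
  obtain ⟨a⟩ := hne ⟨f.top⟩
  obtain ⟨j, hj, ⟨c, hc, hfc⟩, hnext⟩ := exists_last_ordLevel_ge hJ (f.lt_top a)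
  exact (encard_derivTail_lt f hc hfc hnext).ne (he j hj)

theorem encard_derivTail_congr (f : A ≃o B) (j : ℕ) :
    (derivTail (· < ·) (ordLevel A j)).encard = (derivTail (· < ·) (ordLevel B j)).encard := by
  let e : A ≤i B := f.toRelIsoLT.toInitialSeg
  have hrange (D : Set B) : D ⊆ Set.range e.toRelEmbedding := fun b _ => f.surjective b
  rw [← preimage_ordLevel e, ← Set.encard_preimage_of_injective_subset_range e.injective (hrange _)]
  exact congrArg Set.encard (preimage_derivTail e.toRelEmbedding (hrange _)).symm

theorem nonempty_orderIso_iff [WellFoundedLT A] [WellFoundedLT B]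
    (hA : (ordLevel A J).Subsingleton) (hB : (ordLevel B J).Subsingleton) :
    Nonempty (A ≃o B) ↔ (Nonempty A ↔ Nonempty B) ∧
      ∀ j < J, (derivTail (· < ·) (ordLevel A j)).encard =
        (derivTail (· < ·) (ordLevel B j)).encard := by
  constructor
  · rintro ⟨f⟩
    exact ⟨f.toEquiv.nonempty_congr, fun j _ => encard_derivTail_congr f j⟩
  · rintro ⟨hne, he⟩
    have hAB : IsEmpty (A <i B) := isEmpty_principalSeg hB hne.2 he
    have hBA : IsEmpty (B <i A) := isEmpty_principalSeg hA hne.1 fun j hj => (he j hj).symm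
    rcases InitialSeg.total ((· < ·) : A → A → Prop) ((· < ·) : B → B → Prop) with f | f
    · exact f.principalSumRelIso.elim (fun g => hAB.elim g) fun g => ⟨OrderIso.ofRelIsoLT g⟩
    · exact f.principalSumRelIso.elim (fun g => hBA.elim g)
        fun g => ⟨(OrderIso.ofRelIsoLT g).symm⟩

end Comparison

section Delhomme

variable {α : Type*} {D : Set (List α)} {lt : List α → List α → Prop}

/-- At the least point `m` whose initial segment is that large, the initial segment splits into
finitely many parts according to the first `m.length` letters, one of which is still large. -/
theorem exists_large_prefix (hfin : ∀ t, (List.take t '' D).Finite) (hwf : D.WellFoundedOn lt)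
    {j : ℕ} {x : List α} (hx : x ∈ D) (hl : IsLarge lt (j + 1) {z | z ∈ D ∧ lt z x}) :
    ∃ m u : List α, u.length = m.length ∧ ¬ IsLarge lt (j + 2) {z | z ∈ D ∧ lt z m} ∧
      IsLarge lt (j + 1) {z | (z ∈ D ∧ lt z m) ∧ u <+: z} := by
  rw [Set.wellFoundedOn_iff] at hwf
  obtain ⟨m, ⟨hmD, hm⟩, hmin⟩ := hwf.has_min
    {x | x ∈ D ∧ IsLarge lt (j + 1) {z | z ∈ D ∧ lt z x}} ⟨x, hx, hl⟩
  have hcover : {z | z ∈ D ∧ lt z m} ⊆ ⋃ u ∈ List.take m.length '' D,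
      {z | (z ∈ D ∧ lt z m) ∧ z.take m.length = u} := by
    intro z hz
    simp only [Set.mem_iUnion]
    exact ⟨_, ⟨z, hz.1, rfl⟩, hz, rfl⟩
  obtain ⟨u, ⟨w, -, rfl⟩, hu⟩ := (hm.mono hcover).exists_of_biUnion (hfin _)
  refine ⟨m, w.take m.length, ?_, fun hbig => ?_, hu.mono ?_⟩
  · by_contra hshort
    have h_eq : ∀ z : List α, z.take m.length = w.take m.length → z = w.take m.length := by
      intro z hz
      have hlen := congrArg List.length hz
      simp only [List.length_take] at hlen hshort
      rwa [List.take_of_length_le (by omega)] at hz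
    obtain ⟨A, hA, hlA, b, hb, hAb⟩ := hu.exists_bounded_subset
    obtain ⟨a, ha⟩ := hlA.nonempty
    have hab : a = b := (h_eq a (hA ha).2).trans (h_eq b hb.2).symm
    exact hwf.irrefl.irrefl b ⟨hab ▸ hAb a ha, hb.1.1, hb.1.1⟩
  · obtain ⟨A, hA, hlA, b, hb, hAb⟩ := hbig.exists_bounded_subset
    exact hmin b ⟨hb.1, hlA.mono fun a ha => ⟨(hA ha).1, hAb a ha⟩⟩ ⟨hb.2, hb.1, hmD⟩
  · rintro z ⟨hz, hzu⟩
    exact ⟨hz, hzu ▸ List.take_prefix _ _⟩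

/-- Each smaller rank provides a point and a prefix; by pigeonhole two of them have the same
Myhill–Nerode classes, although the parts below them with these prefixes differ in rank. -/
theorem not_isLarge_initial {N₁ N₂ : ℕ} (hfin : ∀ t, (List.take t '' D).Finite)
    (hwf : D.WellFoundedOn lt)
    (h₁ : HasIndex N₁ fun x : Fin 2 → List α => x 0 ∈ D ∧ lt (x 0) (x 1))
    (h₂ : HasIndex N₂ fun x : Fin 2 → List α => lt (x 0) (x 1)) {x : List α} (hx : x ∈ D) :
    ¬ IsLarge lt (N₁ * N₂ + 1) {z | z ∈ D ∧ lt z x} := by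
  intro hl
  choose X U hlen hsmall hlarge using fun j : Fin (N₁ * N₂ + 1) =>
    exists_large_prefix (j := j) hfin hwf hx (hl.of_le (by omega))
  obtain ⟨f₁, hf₁⟩ := h₁
  obtain ⟨f₂, hf₂⟩ := h₂
  let type : Fin (N₁ * N₂ + 1) → Fin N₁ × Fin N₂ := fun j =>
    (f₁ (X j).length ![U j, X j], f₂ (X j).length ![U j, U j])
  obtain ⟨a, b, hab, htype⟩ := Fintype.exists_ne_map_eq_of_card_lt type (by simp)
  wlog hlt : a < b generalizing a b
  · exact this b a hab.symm htype.symm (lt_of_le_of_ne (not_lt.1 hlt) hab.symm)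
  obtain ⟨htype₁, htype₂⟩ := Prod.mk.inj htype
  have htake : ∀ j, (U j).take (X j).length = U j := fun j => List.take_of_length_le (hlen j).le
  have h_below : ∀ v, (U a ++ v ∈ D ∧ lt (U a ++ v) (X a)) ↔
      (U b ++ v ∈ D ∧ lt (U b ++ v) (X b)) := fun v => by
    simpa [splice, hlen, htake] using hf₁ _ _ _ _ htype₁ ![v, []]
  have h_lt : ∀ v w, lt (U a ++ v) (U a ++ w) ↔ lt (U b ++ v) (U b ++ w) := fun v w => by
    simpa [splice, hlen, htake] using hf₂ _ _ _ _ htype₂ ![v, w]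
  have hlarge_b : IsLarge lt (a + 2) {z | (z ∈ D ∧ lt z (X b)) ∧ U b <+: z} :=
    (hlarge b).of_le (by omega)
  refine hsmall a
    ((hlarge_b.image (lt := lt) (φ := fun z => U a ++ z.drop (U b).length) ?_).mono ?_)
  · rintro _ ⟨-, v, rfl⟩ _ ⟨-, w, rfl⟩ h
    simpa using (h_lt v w).2 h
  · rintro _ ⟨_, ⟨hz, v, rfl⟩, rfl⟩
    simpa using (h_below v).2 hz

end Delhomme

/-! ### Words and automata -/

section WordConvolution

variable {α : Type}

theorem wordConvolution_append {u v : List α} (h : u.length = v.length) (y z : List α) :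
    wordConvolution (u ++ y) (v ++ z) = wordConvolution u v ++ wordConvolution y z := by
  induction u generalizing v with
  | nil =>
    obtain rfl : v = [] := List.length_eq_zero_iff.1 h.symm
    simp [wordConvolution]
  | cons a u ih =>
    cases v with
    | nil => simp at h
    | cons b v => simpa [wordConvolution] using ih (by simpa using h)

theorem wordConvolution_append_left {u v : List α} (h : v.length ≤ u.length) (y : List α) :
    wordConvolution (u ++ y) v = wordConvolution u v ++ wordConvolution y [] := by
  induction u generalizing v with
  | nil =>
    obtain rfl : v = [] := List.length_eq_zero_iff.1 (by simpa using h)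
    simp [wordConvolution]
  | cons a u ih =>
    cases v with
    | nil => simp [wordConvolution]
    | cons b v => simpa [wordConvolution] using ih (by simpa using h)

theorem wordConvolution_append_right {u v : List α} (h : u.length ≤ v.length) (y : List α) :
    wordConvolution u (v ++ y) = wordConvolution u v ++ wordConvolution [] y := by
  induction v generalizing u with
  | nil =>
    obtain rfl : u = [] := List.length_eq_zero_iff.1 (by simpa using h)
    simp [wordConvolution]
  | cons a v ih =>
    cases u with
    | nil => simp [wordConvolution]
    | cons b u => simpa [wordConvolution] using ih (by simpa using h)

theorem wordConvolution_map {β : Type} (f : α → β) (u v : List α) :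
    wordConvolution (u.map f) (v.map f) =
      (wordConvolution u v).map fun a => (a.1.map f, a.2.map f) := by
  induction u generalizing v with
  | nil => simp [wordConvolution]
  | cons a u ih =>
    cases v with
    | nil => simp [wordConvolution]
    | cons b v => simpa [wordConvolution] using ih v

theorem forall_mem_wordConvolution_iff (u v : List α) :
    (∀ a ∈ wordConvolution u v, a.1 = a.2) ↔ u = v := by
  induction u generalizing v with
  | nil => cases v <;> simp [wordConvolution]
  | cons a u ih =>
    cases v with
    | nil => simp [wordConvolution]
    | cons b v => simpa [wordConvolution] using fun _ => ih v

theorem wordConvolution_splice {ι : Type*} (t : ℕ) (x y : ι → List α) (i j : ι) :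
    wordConvolution (splice t x y i) (splice t x y j) =
      wordConvolution ((x i).take t) ((x j).take t) ++
        wordConvolution (if t ≤ (x i).length then y i else [])
          (if t ≤ (x j).length then y j else []) := by
  rw [splice_eq_take_append, splice_eq_take_append]
  split_ifs with hi hj hj
  · exact wordConvolution_append (by simp [hi, hj]) _ _
  · rw [List.append_nil]
    exact wordConvolution_append_left (by simp; omega) _
  · rw [List.append_nil]
    exact wordConvolution_append_right (by simp; omega) _
  · simp [wordConvolution]

end WordConvolution

namespace HasIndex

variable {ι : Type*} {α S : Type}

theorem of_word [Finite S] {L : List α → Prop} (q : List α → S)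
    (hq : ∀ u v, q u = q v → ∀ w, L (u ++ w) ↔ L (v ++ w)) (i : ι) :
    HasIndex (2 * Nat.card S) fun x : ι → List α => L (x i) := by
  refine of_card_le (S := Prop × S) (by simp)
    (fun t x => (t ≤ (x i).length, q ((x i).take t))) fun t x t' x' e y => ?_
  obtain ⟨e_len, e_state⟩ := Prod.mk.inj e
  simp only [splice_eq_take_append, e_len, hq _ _ e_state]

theorem of_wordConvolution [Finite S] {L : List (Option α × Option α) → Prop}
    (q : List (Option α × Option α) → S)
    (hq : ∀ u v, q u = q v → ∀ w, L (u ++ w) ↔ L (v ++ w)) (i j : ι) :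
    HasIndex (4 * Nat.card S) fun x : ι → List α => L (wordConvolution (x i) (x j)) := by
  refine of_card_le (S := (Prop × Prop) × S) (by simp)
    (fun t x => ((t ≤ (x i).length, t ≤ (x j).length),
      q (wordConvolution ((x i).take t) ((x j).take t)))) fun t x t' x' e y => ?_
  obtain ⟨e_len, e_state⟩ := Prod.mk.inj e
  obtain ⟨e_len_i, e_len_j⟩ := Prod.mk.inj e_len
  simp only [wordConvolution_splice, e_len_i, e_len_j, hq _ _ e_state]

theorem forall_mem (p : α → Prop) (i : ι) :
    HasIndex 4 fun x : ι → List α => ∀ a ∈ x i, p a := by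
  simpa using of_word (L := fun w => ∀ a ∈ w, p a) (fun w => ∀ a ∈ w, p a)
    (fun _ _ e _ => by simp only [List.forall_mem_append, e]) i

theorem eq (i j : ι) : HasIndex 8 fun x : ι → List α => x i = x j := by
  let L (w : List (Option α × Option α)) : Prop := ∀ a ∈ w, a.1 = a.2
  have h : HasIndex (4 * Nat.card Prop) fun x : ι → List α => L (wordConvolution (x i) (x j)) :=
    of_wordConvolution L
      (fun _ _ e _ => by simp only [L, List.forall_mem_append] at e ⊢; rw [e]) i j
  simpa only [L, forall_mem_wordConvolution_iff, Nat.card_eq_fintype_card, Fintype.card_prop]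
    using h

variable [Fintype S]

theorem accepts (M : NFA α S) (i : ι) :
    HasIndex (2 * 2 ^ Fintype.card S) fun x : ι → List α => x i ∈ M.accepts := by
  simpa using of_word (L := (· ∈ M.accepts)) (M.evalFrom M.start)
    (fun _ _ e _ => by simp only [NFA.mem_accepts, NFA.evalFrom_append, e]) i

theorem wordConvolution_accepts (M : NFA (Option α × Option α) S) (i j : ι) :
    HasIndex (4 * 2 ^ Fintype.card S)
      fun x : ι → List α => wordConvolution (x i) (x j) ∈ M.accepts := by
  simpa using of_wordConvolution (L := (· ∈ M.accepts)) (M.evalFrom M.start)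
    (fun _ _ e _ => by simp only [NFA.mem_accepts, NFA.evalFrom_append, e]) i j

end HasIndex

namespace WordAutomaton

theorem mem_accepts_toNFA_iff {α β : Type} (A : WordAutomaton β) (code : α → β) (w : List α) :
    w ∈ (A.toNFA code).accepts ↔ w.map code ∈ (A.toNFA id).accepts := by
  have evalFrom_map : ∀ S, (A.toNFA code).evalFrom S w = (A.toNFA id).evalFrom S (w.map code) := by
    induction w with
    | nil => exact fun _ => rfl
    | cons _ _ ih => exact fun _ => ih _
  simp only [NFA.mem_accepts, evalFrom_map]
  rfl

/-- The language of `A` over the alphabet `{0, …, k - 1}`, as a set of words of natural numbers: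
in this form the alphabet is a parameter and not a type. -/
def wordSet (A : WordAutomaton ℕ) (k : ℕ) : Set (List ℕ) :=
  {w | (∀ a ∈ w, a < k) ∧ w ∈ (A.toNFA id).accepts}

theorem hasIndex_mem_wordSet {ι : Type*} (A : WordAutomaton ℕ) (k : ℕ) (i : ι) :
    HasIndex (4 * (2 * 2 ^ A.numStates)) fun x : ι → List ℕ => x i ∈ A.wordSet k := by
  have h := (HasIndex.forall_mem (· < k) i).and (HasIndex.accepts (A.toNFA id) i)
  rwa [Fintype.card_fin] at h

end WordAutomaton

/-- The relation `le` is a linear order on `D`. -/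
def LinearOn {W : Type*} (le : W → W → Prop) (D : Set W) : Prop :=
  (∀ x ∈ D, ∀ y ∈ D, le x y ∨ le y x) ∧ (∀ x ∈ D, ∀ y ∈ D, le x y → le y x → x = y) ∧
    ∀ x ∈ D, ∀ y ∈ D, ∀ z ∈ D, le x y → le y z → le x z

namespace AutomaticPresentation

variable (P : AutomaticPresentation)

/-- The domain, as a set of words of natural numbers. -/
def domainSet : Set (List ℕ) := P.domain.wordSet P.alphabetSize

/-- The relation, on words of natural numbers. -/
def wordLe (x y : List ℕ) : Prop := wordConvolution x y ∈ (P.relation.toNFA id).accepts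

/-- The strict part of the relation, on words of natural numbers. -/
def wordLt (x y : List ℕ) : Prop := P.wordLe x y ∧ x ≠ y

/-- The iterated derivatives of the presented structure, as sets of words. -/
def level (j : ℕ) : Set (List ℕ) := iterDeriv P.wordLt P.domainSet j

theorem hasIndex_wordLe {ι : Type*} (i j : ι) :
    HasIndex (4 * 2 ^ P.relation.numStates)
      fun x : ι → List ℕ => P.wordLe (x i) (x j) := by
  have h := HasIndex.wordConvolution_accepts (P.relation.toNFA id) i j
  rwa [Fintype.card_fin] at h

theorem hasIndex_wordLt {ι : Type*} (i j : ι) :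
    HasIndex (4 * 2 ^ P.relation.numStates * 8)
      fun x : ι → List ℕ => P.wordLt (x i) (x j) :=
  (P.hasIndex_wordLe i j).and (HasIndex.eq i j).not

theorem wordLe_map_val (x y : List (Fin P.alphabetSize)) :
    P.wordLe (x.map Fin.val) (y.map Fin.val) ↔ wordConvolution x y ∈ P.relationLanguage := by
  rw [wordLe, wordConvolution_map]
  exact (P.relation.mem_accepts_toNFA_iff _ _).symm

/-- An element of the presented structure, as a word of natural numbers. -/
def toWord : (fun x y : P.Carrier => P.Le x y ∧ x ≠ y) ↪r P.wordLt where
  toFun x := x.1.map Fin.val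
  inj' _ _ h := Subtype.ext (List.map_injective_iff.2 Fin.val_injective h)
  map_rel_iff' {x y} := and_congr (P.wordLe_map_val x.1 y.1)
    ((List.map_injective_iff.2 Fin.val_injective).ne_iff.trans Subtype.val_injective.ne_iff)

theorem wordLe_toWord (x y : P.Carrier) : P.wordLe (P.toWord x) (P.toWord y) ↔ P.Le x y :=
  P.wordLe_map_val x.1 y.1

theorem range_toWord : Set.range P.toWord = P.domainSet := by
  ext w
  constructor
  · rintro ⟨x, rfl⟩
    refine ⟨fun a ha => ?_, (P.domain.mem_accepts_toNFA_iff _ _).1 x.2⟩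
    obtain ⟨b, -, rfl⟩ := List.mem_map.1 ha
    exact b.2
  · rintro ⟨hw, hacc⟩
    obtain ⟨v, rfl⟩ : ∃ v : List (Fin P.alphabetSize), v.map Fin.val = w :=
      ⟨w.pmap (fun a h => ⟨a, h⟩) hw, by simp [List.map_pmap]⟩
    exact ⟨⟨v, (P.domain.mem_accepts_toNFA_iff _ _).2 hacc⟩, rfl⟩

theorem finite_take_domainSet (t : ℕ) : (List.take t '' P.domainSet).Finite := by
  refine ((List.finite_length_le (Fin P.alphabetSize) t).image (List.map Fin.val)).subset ?_
  rintro _ ⟨w, hw, rfl⟩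
  rw [← P.range_toWord] at hw
  obtain ⟨x, rfl⟩ := hw
  exact ⟨x.1.take t, by simp, List.map_take⟩

theorem level_subset_range (j : ℕ) : P.level j ⊆ Set.range P.toWord :=
  P.range_toWord ▸ iterDeriv_subset _ _ j

theorem preimage_level (j : ℕ) :
    P.toWord ⁻¹' P.level j = iterDeriv (fun x y => P.Le x y ∧ x ≠ y) Set.univ j := by
  rw [level, preimage_iterDeriv P.toWord fun b hb _ _ => P.range_toWord ▸ hb, ← P.range_toWord,
    Set.preimage_range]

theorem subsingleton_level_iff (j : ℕ) :
    (P.level j).Subsingleton ↔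
      (iterDeriv (fun x y => P.Le x y ∧ x ≠ y) Set.univ j).Subsingleton := by
  rw [← P.preimage_level]
  refine ⟨fun H => H.preimage P.toWord.injective, fun H => ?_⟩
  rw [← Set.image_preimage_eq_of_subset (P.level_subset_range j)]
  exact H.image _

theorem derivCofinite_level_iff (j : ℕ) :
    DerivCofinite P.wordLt (P.level j) ↔ DerivCofinite (fun x y => P.Le x y ∧ x ≠ y)
      (iterDeriv (fun x y => P.Le x y ∧ x ≠ y) Set.univ j) := by
  rw [← P.preimage_level, derivCofinite_preimage_iff P.toWord (P.level_subset_range j)]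

theorem encard_derivTail_level (j : ℕ) :
    (derivTail P.wordLt (P.level j)).encard = (derivTail (fun x y => P.Le x y ∧ x ≠ y)
      (iterDeriv (fun x y => P.Le x y ∧ x ≠ y) Set.univ j)).encard := by
  rw [← P.preimage_level, ← preimage_derivTail P.toWord (P.level_subset_range j)]
  exact (Set.encard_preimage_of_injective_subset_range P.toWord.injective
    (Set.Subset.trans (fun _ hx => hx.1) (P.level_subset_range j))).symm

theorem isLinearOrder_iff : IsLinearOrder P.Carrier P.Le ↔ LinearOn P.wordLe P.domainSet := by
  simp only [LinearOn, ← P.range_toWord, Set.forall_mem_range, wordLe_toWord,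
    P.toWord.injective.eq_iff]
  constructor
  · intro h
    exact ⟨fun x y => h.total x y, fun x y => h.antisymm x y, fun x y z => h.trans x y z⟩
  · rintro ⟨total, antisymm, trans⟩
    exact { refl := fun x => (total x x).elim id id, trans, antisymm, total }

/-- The linear order on the carrier. -/
noncomputable abbrev linearOrder (h : IsLinearOrder P.Carrier P.Le) : LinearOrder P.Carrier where
  le := P.Le
  lt x y := P.Le x y ∧ x ≠ y
  le_refl := h.refl
  le_trans := h.trans
  le_antisymm := h.antisymm
  le_total := h.total
  lt_iff_le_not_ge x y := and_congr_right fun hxy =>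
    not_congr ⟨fun e => e ▸ hxy, h.antisymm x y hxy⟩
  toDecidableLE := Classical.decRel _

/-- More than the number of derivatives of an automatic ordinal that have at least two points. -/
def rankBound : ℕ :=
  4 * (2 * 2 ^ P.domain.numStates) * (4 * 2 ^ P.relation.numStates * 8) *
    (4 * 2 ^ P.relation.numStates * 8) + 1

variable {P} {Q : AutomaticPresentation}

theorem IsOrdinal.wellFoundedOn_domainSet (hP : P.IsOrdinal) :
    P.domainSet.WellFoundedOn P.wordLt := by
  rw [← P.range_toWord, Set.wellFoundedOn_range]
  refine Subrelation.wf (fun h => ?_) hP.2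
  exact P.toWord.map_rel_iff.1 h

theorem IsOrdinal.subsingleton_level (hP : P.IsOrdinal) {J : ℕ} (hJ : P.rankBound ≤ J) :
    (P.level J).Subsingleton := by
  let _ := P.linearOrder hP.1
  have : WellFoundedLT P.Carrier := ⟨hP.2⟩
  have not_lt_of_mem : ∀ x ∈ ordLevel P.Carrier J, ∀ y ∈ ordLevel P.Carrier J, ¬ y < x := by
    intro x hx y hy hyx
    have large : IsLarge P.wordLt J {z | z ∈ P.domainSet ∧ P.wordLt z (P.toWord x)} :=
      ((isLarge_Ico hy hx hyx).image (φ := P.toWord) fun _ _ _ _ => P.toWord.map_rel_iff.2).mono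
        (by
          rintro _ ⟨z, hz, rfl⟩
          exact ⟨P.range_toWord ▸ Set.mem_range_self z, P.toWord.map_rel_iff.2 hz.2⟩)
    exact not_isLarge_initial P.finite_take_domainSet hP.wellFoundedOn_domainSet
      ((P.domain.hasIndex_mem_wordSet _ 0).and (P.hasIndex_wordLt 0 1)) (P.hasIndex_wordLt 0 1)
      (P.range_toWord ▸ Set.mem_range_self x) (large.of_le hJ)
  exact (P.subsingleton_level_iff J).2 fun x hx y hy =>
    le_antisymm (not_lt.1 (not_lt_of_mem x hx y hy)) (not_lt.1 (not_lt_of_mem y hy x hx))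

theorem isOrdinal_iff :
    P.IsOrdinal ↔ LinearOn P.wordLe P.domainSet ∧
      (∀ j < P.rankBound, DerivCofinite P.wordLt (P.level j)) ∧
        (P.level P.rankBound).Subsingleton := by
  rw [← isLinearOrder_iff]
  constructor
  · intro hP
    let _ := P.linearOrder hP.1
    have : WellFoundedLT P.Carrier := ⟨hP.2⟩
    exact ⟨hP.1, fun j _ => (P.derivCofinite_level_iff j).2 (derivCofinite_of_wellFoundedLT _),
      hP.subsingleton_level le_rfl⟩
  · rintro ⟨hlin, hcof, hsub⟩
    let _ := P.linearOrder hlin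
    simp only [derivCofinite_level_iff] at hcof
    exact ⟨hlin, (wellFoundedLT_of_derivCofinite hcof ((P.subsingleton_level_iff _).1 hsub)).wf⟩

theorem IsOrdinal.isomorphic_iff (hP : P.IsOrdinal) (hQ : Q.IsOrdinal) :
    P.Isomorphic Q ↔ (P.domainSet.Nonempty ↔ Q.domainSet.Nonempty) ∧
      ∀ j < P.rankBound + Q.rankBound,
        (derivTail P.wordLt (P.level j)).encard = (derivTail Q.wordLt (Q.level j)).encard := by
  let _ := P.linearOrder hP.1
  let _ := Q.linearOrder hQ.1
  have : WellFoundedLT P.Carrier := ⟨hP.2⟩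
  have : WellFoundedLT Q.Carrier := ⟨hQ.2⟩
  simp only [← range_toWord, Set.range_nonempty_iff_nonempty, encard_derivTail_level]
  exact nonempty_orderIso_iff
    ((P.subsingleton_level_iff _).1 (hP.subsingleton_level (Nat.le_add_right _ _)))
    ((Q.subsingleton_level_iff _).1 (hQ.subsingleton_level (Nat.le_add_left _ _)))

end AutomaticPresentation

/-! ### Primitive recursive decision procedures -/

section PrimitiveRecursion

variable {γ β : Type} [Primcodable γ] [Primcodable β]

theorem primrecPred_imp {p q : γ → Prop} (hp : PrimrecPred p) (hq : PrimrecPred q) :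
    PrimrecPred fun a => p a → q a :=
  (hp.not.or hq).of_eq fun _ => imp_iff_not_or.symm

theorem primrecPred_iff {p q : γ → Prop} (hp : PrimrecPred p) (hq : PrimrecPred q) :
    PrimrecPred fun a => p a ↔ q a :=
  ((primrecPred_imp hp hq).and (primrecPred_imp hq hp)).of_eq fun _ => iff_def.symm

theorem primrecPred_forall_mem {f : γ → List β} {p : γ → β → Prop} (hf : Primrec f)
    (hp : PrimrecPred fun a : γ × β => p a.1 a.2) : PrimrecPred fun a => ∀ b ∈ f a, p a b :=
  (PrimrecRel.forall_mem_list (R := fun b a => p a b) (PrimrecRel.swap hp)).comp hf Primrec.id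

theorem primrecPred_exists_mem {f : γ → List β} {p : γ → β → Prop} (hf : Primrec f)
    (hp : PrimrecPred fun a : γ × β => p a.1 a.2) : PrimrecPred fun a => ∃ b ∈ f a, p a b :=
  (PrimrecRel.exists_mem_list (R := fun b a => p a b) (PrimrecRel.swap hp)).comp hf Primrec.id

theorem primrec_filter {f : γ → List β} {p : γ → β → Prop} [∀ a, DecidablePred (p a)]
    (hf : Primrec f) (hp : PrimrecPred fun a : γ × β => p a.1 a.2) :
    Primrec fun a => (f a).filter (p a ·) :=
  (PrimrecRel.listFilter (R := fun b a => p a b) (PrimrecRel.swap hp)).comp hf Primrec.id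

theorem primrecPred_mem {f : γ → List β} {g : γ → β} (hf : Primrec f) (hg : Primrec g) :
    PrimrecPred fun a => g a ∈ f a :=
  (primrecPred_exists_mem hf (p := fun a b => b = g a)
    (Primrec.eq.comp Primrec.snd (hg.comp Primrec.fst))).of_eq fun a => by simp

theorem primrec_two_pow {f : γ → ℕ} (hf : Primrec f) : Primrec fun a => 2 ^ f a :=
  (Primrec₂.unpaired'.1 Nat.Primrec.pow).comp (Primrec.const 2) hf

theorem primrec_pi_iff {n : ℕ} {f : γ → Fin n → β} :
    Primrec f ↔ ∀ i, Primrec fun a => f a i :=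
  ⟨fun h i => Primrec.fin_app.comp h (Primrec.const i), fun h =>
    Primrec.fin_curry.2 (Primrec₂.swap (Primrec.fin_curry₁ (f := fun i a => f a i) |>.2 h))⟩

theorem primrec_update {n : ℕ} {x : γ → Fin n → β} {w : γ → β} (hx : Primrec x) (hw : Primrec w)
    (i : Fin n) : Primrec fun a => Function.update (x a) i (w a) :=
  primrec_pi_iff.2 fun j => by
    by_cases h : j = i
    · subst h; simpa using hw
    · simpa [h] using primrec_pi_iff.1 hx j

theorem primrecPred_exists_pi_mem {n : ℕ} {f : γ → List β} {p : γ → (Fin n → β) → Prop}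
    (hf : Primrec f) (hp : PrimrecPred fun a : γ × (Fin n → β) => p a.1 a.2) :
    PrimrecPred fun a => ∃ x, (∀ i, x i ∈ f a) ∧ p a x := by
  induction n generalizing γ with
  | zero =>
    refine (hp.comp (Primrec.pair Primrec.id (Primrec.const Fin.elim0))).of_eq fun a => ?_
    simp [Subsingleton.elim (default : Fin 0 → β) Fin.elim0, Unique.exists_iff]
  | succ n ih =>
    have hcons : Primrec fun q : (γ × β) × (Fin n → β) =>
        (q.1.1, (Fin.cons q.1.2 q.2 : Fin (n + 1) → β)) :=
      Primrec.pair (Primrec.fst.comp Primrec.fst) (primrec_pi_iff.2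
        (Fin.cases (Primrec.snd.comp Primrec.fst) fun i => primrec_pi_iff.1 Primrec.snd i))
    refine (primrecPred_exists_mem hf (p := fun a b => ∃ x, (∀ i, x i ∈ f a) ∧ p a (Fin.cons b x))
      (ih (hf.comp Primrec.fst) (p := fun a x => p a.1 (Fin.cons a.2 x))
        (hp.comp hcons))).of_eq fun a => ?_
    simp only [Fin.exists_fin_succ_pi, Fin.forall_fin_succ, Fin.cons_zero, Fin.cons_succ]
    exact exists_congr fun b => by rw [← exists_and_left]; simp only [and_assoc]

end PrimitiveRecursion

/-- The words over `{0, …, k - 1}` of length at most `m`. -/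
def wordList (k : ℕ) : ℕ → List (List ℕ)
  | 0 => [[]]
  | m + 1 => [] :: (wordList k m).flatMap fun w => (List.range k).map fun a => a :: w

theorem mem_wordList {k m : ℕ} {w : List ℕ} :
    w ∈ wordList k m ↔ (∀ a ∈ w, a < k) ∧ w.length ≤ m := by
  induction m generalizing w with
  | zero => cases w <;> simp [wordList]
  | succ m ih =>
    cases w with
    | nil => simp [wordList]
    | cons a w => simp [wordList, ih]; tauto

theorem nodup_wordList (k m : ℕ) : (wordList k m).Nodup := by
  induction m with
  | zero => simp [wordList]
  | succ m ih =>
    refine List.nodup_cons.2 ⟨by simp, List.nodup_flatMap.2 ⟨fun w _ => ?_, ?_⟩⟩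
    · exact List.nodup_range.map fun a b h => (List.cons.inj h).1
    · refine ih.imp fun {u v} huv w hu hv => ?_
      obtain ⟨a, -, rfl⟩ := List.mem_map.1 hu
      obtain ⟨b, -, h⟩ := List.mem_map.1 hv
      exact huv (List.cons.inj h).2.symm

theorem primrec_wordList : Primrec₂ wordList := by
  have h : Primrec₂ fun (k m : ℕ) => (Nat.rec [[]] (fun _ V => [] :: V.flatMap fun w =>
      (List.range k).map fun a => a :: w) m : List (List ℕ)) :=
    Primrec.nat_rec (f := fun _ => [[]]) (g := fun k q => [] :: q.2.flatMap fun w =>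
      (List.range k).map fun a => a :: w) (Primrec.const _)
      (Primrec.list_cons.comp (Primrec.const []) (Primrec.list_flatMap
        (Primrec.snd.comp Primrec.snd)
        (Primrec.list_map (Primrec.list_range.comp (Primrec.fst.comp Primrec.fst))
          (Primrec.list_cons.comp Primrec.snd (Primrec.snd.comp Primrec.fst)))))
  refine h.of_eq fun k m => ?_
  induction m with
  | zero => rfl
  | succ m ih => simp only [wordList, ih]

theorem wordConvolution_eq_map_range {α : Type} (x y : List α) :
    wordConvolution x y =
      (List.range (max x.length y.length)).map fun i => (x[i]?, y[i]?) := by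
  refine List.ext_getElem? fun i => ?_
  rw [wordConvolution, List.getElem?_zipWithAll, List.getElem?_map]
  by_cases h : i < max x.length y.length
  · have hxy : x[i]? ≠ none ∨ y[i]? ≠ none := by simpa using lt_max_iff.1 h
    rw [List.getElem?_range h, Option.map_some]
    cases hx : x[i]? <;> cases hy : y[i]? <;> simp_all
  · obtain ⟨hx, hy⟩ := max_le_iff.1 (not_lt.1 h)
    rw [List.getElem?_eq_none hx, List.getElem?_eq_none hy,
      List.getElem?_eq_none (by simpa using ⟨hx, hy⟩)]
    rfl

section PrimitiveRecursiveAutomata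

variable {γ β : Type} [Primcodable γ] [Primcodable β]

theorem primrec_wordConvolution {x y : γ → List β} (hx : Primrec x) (hy : Primrec y) :
    Primrec fun a => wordConvolution (x a) (y a) := by
  refine Primrec.of_eq ?_ fun a => (wordConvolution_eq_map_range (x a) (y a)).symm
  exact Primrec.list_map (Primrec.list_range.comp
    (Primrec.nat_max.comp (Primrec.list_length.comp hx) (Primrec.list_length.comp hy)))
    ((Primrec.list_getElem?.comp (hx.comp Primrec.fst) Primrec.snd).pair
      (Primrec.list_getElem?.comp (hy.comp Primrec.fst) Primrec.snd))

namespace WordAutomaton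

theorem primrec_equivProd : Primrec (equivProd β) := Primrec.of_equiv

variable {A : γ → WordAutomaton β}

theorem primrec_numStates (hA : Primrec A) : Primrec fun a => (A a).numStates :=
  Primrec.fst.comp (primrec_equivProd.comp hA)

theorem primrec_start (hA : Primrec A) : Primrec fun a => (A a).start :=
  Primrec.fst.comp (Primrec.snd.comp (primrec_equivProd.comp hA))

theorem primrec_trans (hA : Primrec A) : Primrec fun a => (A a).trans :=
  Primrec.fst.comp (Primrec.snd.comp (Primrec.snd.comp (primrec_equivProd.comp hA)))

theorem primrec_accept (hA : Primrec A) : Primrec fun a => (A a).accept :=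
  Primrec.snd.comp (Primrec.snd.comp (Primrec.snd.comp (primrec_equivProd.comp hA)))

open Classical in
/-- The states reached from a state in `S` by reading `a`. -/
noncomputable def stepList {σ : Type} (A : WordAutomaton σ) (S : List ℕ) (a : σ) : List ℕ :=
  (A.trans.filter fun t => t.1 ∈ S ∧ t.2.1 = a ∧ t.2.2 < A.numStates).map fun t => t.2.2

/-- The states reached from the initial state by reading `w`. -/
noncomputable def runList {σ : Type} (A : WordAutomaton σ) (w : List σ) : List ℕ :=
  w.foldl A.stepList (if A.start < A.numStates then [A.start] else [])

theorem mem_stepList_iff {σ : Type} (A : WordAutomaton σ) {S : List ℕ} {a : σ} {r : ℕ} :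
    r ∈ A.stepList S a ↔ r < A.numStates ∧ ∃ q ∈ S, (q, a, r) ∈ A.trans := by
  simp only [stepList, List.mem_map, List.mem_filter, decide_eq_true_eq]
  constructor
  · rintro ⟨⟨q, b, s⟩, ⟨ht, hq, rfl, hs⟩, rfl⟩
    exact ⟨hs, q, hq, ht⟩
  · rintro ⟨hr, q, hq, ht⟩
    exact ⟨_, ⟨ht, hq, rfl, hr⟩, rfl⟩

theorem mem_runList_iff {σ : Type} (A : WordAutomaton σ) (w : List σ) (r : ℕ) :
    r ∈ A.runList w ↔ ∃ q ∈ (A.toNFA id).eval w, (q : ℕ) = r := by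
  induction w using List.reverseRecOn generalizing r with
  | nil =>
    simp only [runList, List.foldl_nil, NFA.eval_nil]
    split_ifs with h
    · exact ⟨fun hr => ⟨⟨A.start, h⟩, rfl, (List.mem_singleton.1 hr).symm⟩,
        fun ⟨_, hq, hr⟩ => List.mem_singleton.2 (hr ▸ hq)⟩
    · exact ⟨fun hr => absurd hr List.not_mem_nil,
        fun ⟨q, hq, _⟩ => absurd (hq ▸ q.2 : A.start < A.numStates) h⟩
  | append_singleton w a ih =>
    rw [runList, List.foldl_append, List.foldl_cons, List.foldl_nil, ← runList, mem_stepList_iff,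
      NFA.eval_append_singleton]
    simp only [NFA.mem_stepSet, ih]
    constructor
    · rintro ⟨hr, _, ⟨q, hq, rfl⟩, ht⟩
      exact ⟨⟨r, hr⟩, ⟨q, hq, ht⟩, rfl⟩
    · rintro ⟨s, ⟨q, hq, ht⟩, rfl⟩
      exact ⟨s.2, q, ⟨q, hq, rfl⟩, ht⟩

theorem mem_accepts_iff {σ : Type} (A : WordAutomaton σ) (w : List σ) :
    w ∈ (A.toNFA id).accepts ↔ ∃ q ∈ A.runList w, q ∈ A.accept := by
  simp only [mem_runList_iff]
  constructor
  · rintro ⟨q, hq, hw⟩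
    exact ⟨q, ⟨q, hw, rfl⟩, hq⟩
  · rintro ⟨_, ⟨q, hw, rfl⟩, hq⟩
    exact ⟨q, hq, hw⟩

theorem primrec_stepList {S : γ → List ℕ} {b : γ → β} (hA : Primrec A) (hS : Primrec S)
    (hb : Primrec b) : Primrec fun a => (A a).stepList (S a) (b a) := by
  classical
  refine Primrec.list_map (primrec_filter (primrec_trans hA) ?_)
    (Primrec.snd.comp (Primrec.snd.comp Primrec.snd))
  exact (primrecPred_mem (hS.comp Primrec.fst) (Primrec.fst.comp Primrec.snd)).and
    ((Primrec.eq.comp (Primrec.fst.comp (Primrec.snd.comp Primrec.snd))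
      (hb.comp Primrec.fst)).and
      (Primrec.nat_lt.comp (Primrec.snd.comp (Primrec.snd.comp Primrec.snd))
        (primrec_numStates (hA.comp Primrec.fst))))

theorem primrec_runList {w : γ → List β} (hA : Primrec A) (hw : Primrec w) :
    Primrec fun a => (A a).runList (w a) :=
  Primrec.list_foldl (h := fun a q => (A a).stepList q.1 q.2) hw
    (Primrec.ite (Primrec.nat_lt.comp (primrec_start hA) (primrec_numStates hA))
      (Primrec.list_cons.comp (primrec_start hA) (Primrec.const [])) (Primrec.const []))
    (primrec_stepList (hA.comp Primrec.fst) (Primrec.fst.comp Primrec.snd)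
      (Primrec.snd.comp Primrec.snd))

theorem primrecPred_accepts {w : γ → List β} (hA : Primrec A) (hw : Primrec w) :
    PrimrecPred fun a => w a ∈ ((A a).toNFA id).accepts :=
  (primrecPred_exists_mem (primrec_runList hA hw) (p := fun a q => q ∈ (A a).accept)
    (primrecPred_mem (primrec_accept (hA.comp Primrec.fst)) Primrec.snd)).of_eq fun a =>
      ((A a).mem_accepts_iff (w a)).symm

theorem primrecPred_mem_wordSet {A : γ → WordAutomaton ℕ} {k : γ → ℕ} {w : γ → List ℕ}
    (hA : Primrec A) (hk : Primrec k) (hw : Primrec w) :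
    PrimrecPred fun a => w a ∈ (A a).wordSet (k a) :=
  (primrecPred_forall_mem hw (p := fun a b => b < k a)
    (Primrec.nat_lt.comp Primrec.snd (hk.comp Primrec.fst))).and (primrecPred_accepts hA hw)

end WordAutomaton

namespace AutomaticPresentation

theorem primrec_equivProd : Primrec equivProd := Primrec.of_equiv

variable {P : γ → AutomaticPresentation}

theorem primrec_alphabetSize (hP : Primrec P) : Primrec fun a => (P a).alphabetSize :=
  Primrec.fst.comp (primrec_equivProd.comp hP)

theorem primrec_domain (hP : Primrec P) : Primrec fun a => (P a).domain :=
  Primrec.fst.comp (Primrec.snd.comp (primrec_equivProd.comp hP))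

theorem primrec_relation (hP : Primrec P) : Primrec fun a => (P a).relation :=
  Primrec.snd.comp (Primrec.snd.comp (primrec_equivProd.comp hP))

theorem primrecPred_wordLe {x y : γ → List ℕ} (hP : Primrec P) (hx : Primrec x) (hy : Primrec y) :
    PrimrecPred fun a => (P a).wordLe (x a) (y a) :=
  WordAutomaton.primrecPred_accepts (primrec_relation hP) (primrec_wordConvolution hx hy)

theorem primrec_rankBound : Primrec rankBound :=
  have index_lt := Primrec.nat_mul.comp (Primrec.nat_mul.comp (Primrec.const 4)
    (primrec_two_pow (WordAutomaton.primrec_numStates (primrec_relation Primrec.id))))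
    (Primrec.const 8)
  have index_domain := Primrec.nat_mul.comp (Primrec.const 4) (Primrec.nat_mul.comp
    (Primrec.const 2)
    (primrec_two_pow (WordAutomaton.primrec_numStates (primrec_domain Primrec.id))))
  Primrec.succ.comp (Primrec.nat_mul.comp (Primrec.nat_mul.comp index_domain index_lt) index_lt)

end AutomaticPresentation

end PrimitiveRecursiveAutomata

/-- A family of relations between words, with a primitive recursive decision procedure and a
primitive recursive index bound. The parameter `a` will be an automatic presentation, possibly
together with further automata or a natural number. -/
structure UniformlyRegular {γ : Type} [Primcodable γ] {m : ℕ}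
    (R : γ → (Fin m → List ℕ) → Prop) : Prop where
  primrecPred : PrimrecPred fun p : γ × (Fin m → List ℕ) => R p.1 p.2
  exists_index : ∃ N : γ → ℕ, Primrec N ∧ ∀ a, HasIndex (N a) (R a)

theorem infinite_iff_forall_exists_le_length {S : Set (List ℕ)} {k : ℕ}
    (hS : ∀ w ∈ S, ∀ c ∈ w, c < k) : S.Infinite ↔ ∀ n, ∃ w : List ℕ, n ≤ w.length ∧ w ∈ S := by
  constructor
  · intro hinf n
    by_contra! hn
    exact hinf ((wordList k n).finite_toSet.subset fun w hw =>
      mem_wordList.2 ⟨hS w hw, not_lt.1 fun hlt => hn w hlt.le hw⟩)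
  · intro H hfin
    obtain ⟨m, hm⟩ := (hfin.image List.length).bddAbove
    obtain ⟨w, hlen, hw⟩ := H (m + 1)
    exact absurd (hm (Set.mem_image_of_mem _ hw)) (by omega)

theorem length_le_length_flatten_ofFn {m : ℕ} {α : Type*} (x : Fin m → List α) (j : Fin m) :
    (x j).length ≤ (List.ofFn x).flatten.length :=
  (List.sublist_flatten_of_mem (List.mem_ofFn.2 ⟨j, rfl⟩)).length_le

namespace UniformlyRegular

variable {γ : Type} [Primcodable γ] {m n : ℕ}
  {R Q : γ → (Fin m → List ℕ) → Prop} {k : γ → ℕ} {i : Fin m}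
  {L : γ → Set (List ℕ)}

theorem not (h : UniformlyRegular R) : UniformlyRegular fun a x => ¬ R a x where
  primrecPred := h.primrecPred.not
  exists_index :=
    let ⟨N, hN, hi⟩ := h.exists_index
    ⟨N, hN, fun a => (hi a).not⟩

theorem and (h : UniformlyRegular R) (h' : UniformlyRegular Q) :
    UniformlyRegular fun a x => R a x ∧ Q a x where
  primrecPred := h.primrecPred.and h'.primrecPred
  exists_index :=
    let ⟨N, hN, hi⟩ := h.exists_index
    let ⟨M, hM, hi'⟩ := h'.exists_index
    ⟨fun a => N a * M a, Primrec.nat_mul.comp hN hM, fun a => (hi a).and (hi' a)⟩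

theorem reindex (h : UniformlyRegular R) (σ : Fin m → Fin n) :
    UniformlyRegular fun a (x : Fin n → List ℕ) => R a fun i => x (σ i) where
  primrecPred := h.primrecPred.comp (Primrec.pair Primrec.fst
    (primrec_pi_iff.2 fun i => primrec_pi_iff.1 Primrec.snd (σ i)))
  exists_index :=
    let ⟨N, hN, hi⟩ := h.exists_index
    ⟨N, hN, fun a => (hi a).reindex σ⟩

theorem primrec_length_flatten_ofFn :
    Primrec fun p : γ × (Fin m → List ℕ) => (List.ofFn p.2).flatten.length :=
  Primrec.list_length.comp (Primrec.list_flatten.comp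
    (Primrec.list_ofFn fun i => primrec_pi_iff.1 Primrec.snd i))

theorem exists_update (h : UniformlyRegular R) (hk : Primrec k)
    (hR : ∀ a x, R a x → ∀ c ∈ x i, c < k a) :
    UniformlyRegular fun a x => ∃ w, R a (Function.update x i w) := by
  obtain ⟨N, hN, hi⟩ := h.exists_index
  refine ⟨?_, fun a => 2 ^ N a, primrec_two_pow hN, fun a => (hi a).exists_update i⟩
  have search : ∀ p : γ × (Fin m → List ℕ),
      (∃ w ∈ wordList (k p.1) ((List.ofFn p.2).flatten.length + N p.1),
        R p.1 (Function.update p.2 i w)) ↔ ∃ w, R p.1 (Function.update p.2 i w) := by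
    rintro ⟨a, x⟩
    refine ⟨fun ⟨w, _, hw⟩ => ⟨w, hw⟩, fun ⟨w, hw⟩ => ?_⟩
    obtain ⟨w', hlen, hw'⟩ :=
      (hi a).exists_short_update (fun j _ => length_le_length_flatten_ofFn x j) hw
    exact ⟨w', mem_wordList.2 ⟨by simpa using hR a _ hw', hlen⟩, hw'⟩
  refine PrimrecPred.of_eq (primrecPred_exists_mem ?_ ?_) search
  · exact primrec_wordList.comp (hk.comp Primrec.fst)
      (Primrec.nat_add.comp primrec_length_flatten_ofFn (hN.comp Primrec.fst))
  · exact h.primrecPred.comp (Primrec.pair (Primrec.fst.comp Primrec.fst)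
      (primrec_update (Primrec.snd.comp Primrec.fst) Primrec.snd i))

theorem infinite_update (h : UniformlyRegular R) (hk : Primrec k)
    (hR : ∀ a x, R a x → ∀ c ∈ x i, c < k a) :
    UniformlyRegular fun a x => {w | R a (Function.update x i w)}.Infinite := by
  obtain ⟨N, hN, hi⟩ := h.exists_index
  have infinite_iff : ∀ a x, {w | R a (Function.update x i w)}.Infinite ↔
      ∀ n, ∃ w : List ℕ, n ≤ w.length ∧ R a (Function.update x i w) := fun a x =>
    infinite_iff_forall_exists_le_length fun w hw => by simpa using hR a _ hw
  simp only [infinite_iff]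
  refine ⟨?_, fun a => 2 ^ N a, primrec_two_pow hN, fun a => (hi a).unbounded_update i⟩
  have search : ∀ p : γ × (Fin m → List ℕ),
      (∃ w ∈ wordList (k p.1) ((List.ofFn p.2).flatten.length + 2 * N p.1),
        (List.ofFn p.2).flatten.length + N p.1 < w.length ∧ R p.1 (Function.update p.2 i w)) ↔
      ∀ n, ∃ w : List ℕ, n ≤ w.length ∧ R p.1 (Function.update p.2 i w) := by
    rintro ⟨a, x⟩
    rw [(hi a).unbounded_update_iff fun j _ => length_le_length_flatten_ofFn x j]
    exact ⟨fun ⟨w, hmem, hlt, hw⟩ => ⟨w, hlt, (mem_wordList.1 hmem).2, hw⟩,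
      fun ⟨w, hlt, hle, hw⟩ => ⟨w, mem_wordList.2 ⟨by simpa using hR a _ hw, hle⟩, hlt, hw⟩⟩
  refine PrimrecPred.of_eq (primrecPred_exists_mem ?_ (.and ?_ ?_)) search
  · exact primrec_wordList.comp (hk.comp Primrec.fst) (Primrec.nat_add.comp
      primrec_length_flatten_ofFn (Primrec.nat_mul.comp (Primrec.const 2) (hN.comp Primrec.fst)))
  · exact Primrec.nat_lt.comp (Primrec.nat_add.comp (primrec_length_flatten_ofFn.comp Primrec.fst)
      (hN.comp (Primrec.fst.comp Primrec.fst))) (Primrec.list_length.comp Primrec.snd)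
  · exact h.primrecPred.comp (Primrec.pair (Primrec.fst.comp Primrec.fst)
      (primrec_update (Primrec.snd.comp Primrec.fst) Primrec.snd i))

theorem primrecPred_exists (h : UniformlyRegular R) (hk : Primrec k)
    (hR : ∀ a x, R a x → ∀ j, ∀ c ∈ x j, c < k a) : PrimrecPred fun a => ∃ x, R a x := by
  obtain ⟨N, hN, hi⟩ := h.exists_index
  refine (primrecPred_exists_pi_mem (primrec_wordList.comp hk hN) h.primrecPred).of_eq
    fun a => ⟨fun ⟨x, _, hx⟩ => ⟨x, hx⟩, fun ⟨x, hx⟩ => ?_⟩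
  obtain ⟨x', hx', -, hlen⟩ := (hi a).exists_short 0 hx
  exact ⟨x', fun j => mem_wordList.2 ⟨hR a x' hx' j, by simpa using hlen j⟩, hx'⟩

theorem primrecPred_mem (h : UniformlyRegular fun a (x : Fin 1 → List ℕ) => x 0 ∈ L a) :
    PrimrecPred fun p : γ × List ℕ => p.2 ∈ L p.1 :=
  h.primrecPred.comp (Primrec.pair Primrec.fst (primrec_pi_iff.2 fun _ => Primrec.snd))

theorem exists_primrec_encard
    (h : UniformlyRegular fun a (x : Fin 1 → List ℕ) => x 0 ∈ L a) (hk : Primrec k)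
    (hL : ∀ a, ∀ w ∈ L a, ∀ c ∈ w, c < k a) :
    ∃ f : γ → Option ℕ, Primrec f ∧ ∀ a, (L a).encard = (f a).elim ⊤ (↑) := by
  classical
  obtain ⟨N, hN, hi⟩ := h.exists_index
  have primrecPred_infinite : PrimrecPred fun a => (L a).Infinite :=
    (h.infinite_update (i := 0) hk fun a x => hL a (x 0)).primrecPred.comp
      (Primrec.pair Primrec.id (Primrec.const fun _ => []))
  have infinite_of_long : ∀ a, ∀ w ∈ L a, N a < w.length → (L a).Infinite := fun a w hw hlong => by
    have hnil : ∀ j : Fin 1, j ≠ 0 → ([] : List ℕ).length ≤ 0 := by simp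
    have hshort := (hi a).exists_moderate_update hnil (by simpa using hlong) hw
    exact (infinite_iff_forall_exists_le_length (hL a)).2
      (((hi a).unbounded_update_iff hnil).2 hshort)
  refine ⟨fun a => if (L a).Infinite then none
    else some ((wordList (k a) (N a)).filter (· ∈ L a)).length, ?_, fun a => ?_⟩
  · exact Primrec.ite primrecPred_infinite (Primrec.const none) (Primrec.option_some.comp
      (Primrec.list_length.comp (primrec_filter (primrec_wordList.comp hk hN)
        h.primrecPred_mem)))
  · by_cases hinf : (L a).Infinite
    · simp [hinf]
    · have h_words : L a = ((wordList (k a) (N a)).filter (· ∈ L a)).toFinset := by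
        ext w
        simpa [mem_wordList] using fun hw =>
          ⟨hL a w hw, not_lt.1 fun hlong => hinf (infinite_of_long a w hw hlong)⟩
      simp only [hinf, if_false, Option.elim_some]
      rw [h_words, Set.encard_coe_eq_coe_finsetCard,
        List.toFinset_card_of_nodup ((nodup_wordList _ _).filter _), ← h_words]

end UniformlyRegular

theorem HasIndex.append_left {ι α : Type*} {N : ℕ} {R : (ι → List α) → Prop} (h : HasIndex N R)
    (u : List α) : HasIndex N fun x => R fun i => u ++ x i := by
  obtain ⟨f, hf⟩ := h
  have splice_append : ∀ t (x y : ι → List α), (fun i => u ++ splice t x y i) =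
      splice (u.length + t) (fun i => u ++ x i) y := fun t x y => by
    funext i
    by_cases ht : t ≤ (x i).length <;> simp [splice, ht, List.take_length_add_append]
  exact ⟨fun t x => f (u.length + t) fun i => u ++ x i, fun t x t' x' e y => by
    simpa only [splice_append] using hf _ _ _ _ e y⟩

/-- Myhill–Nerode equivalence of words with respect to the language `L`. -/
def NerodeEquiv {α : Type*} (L : Set (List α)) (u v : List α) : Prop :=
  ∀ y, u ++ y ∈ L ↔ v ++ y ∈ L

section Residual

variable {L : Set (List ℕ)} {k N : ℕ}

theorem exists_mem_wordList_nerodeEquiv (h : HasIndex N fun x : Fin 1 → List ℕ => x 0 ∈ L)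
    {w : List ℕ} (hw : ∀ c ∈ w, c < k) : ∃ v ∈ wordList k N, NerodeEquiv L w v := by
  induction hs : w.length using Nat.strong_induction_on generalizing w with
  | _ s ih =>
    by_cases hshort : w.length ≤ N
    · exact ⟨w, mem_wordList.2 ⟨hw, hshort⟩, fun _ => Iff.rfl⟩
    obtain ⟨a, b, -, hab, hb, H⟩ := h.exists_splice_iff_splice 0 fun _ => w
    have hcut : NerodeEquiv L w (w.take a ++ w.drop b) := fun y => by
      have := H fun _ => w.drop b ++ y
      simp only [splice, show a ≤ w.length by omega, show b ≤ w.length by omega, if_true] at this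
      rw [List.append_assoc, this, ← List.append_assoc, List.take_append_drop]
    obtain ⟨v, hv, hwv⟩ := ih (w.take a ++ w.drop b).length (by simp; omega) (fun c hc =>
      hw c ((List.mem_append.1 hc).elim List.mem_of_mem_take List.mem_of_mem_drop)) rfl
    exact ⟨v, hv, fun y => (hcut y).trans (hwv y)⟩

theorem nerodeEquiv_iff (h : HasIndex N fun x : Fin 1 → List ℕ => x 0 ∈ L)
    (hL : ∀ w ∈ L, ∀ c ∈ w, c < k) {u v : List ℕ} :
    NerodeEquiv L u v ↔ ∀ y ∈ wordList k (N * N), u ++ y ∈ L ↔ v ++ y ∈ L := by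
  refine ⟨fun huv y _ => huv y, fun H => ?_⟩
  by_contra hne
  obtain ⟨y, hy⟩ := not_forall.1 hne
  obtain ⟨x, hx, -, hlen⟩ := ((h.append_left u).iff (h.append_left v)).not.exists_short 0
    (x := fun _ => y) hy
  refine hx (H (x 0) (mem_wordList.2 ⟨fun c hc => ?_, by simpa using hlen 0⟩))
  by_cases hu : u ++ x 0 ∈ L
  · exact hL _ hu c (List.mem_append_right _ hc)
  · have hv : v ++ x 0 ∈ L := by_contra fun hv => hx (iff_of_false hu hv)
    exact hL _ hv c (List.mem_append_right _ hc)

open Classical in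
/-- The position in `wordList k N` of a representative of the Myhill–Nerode class of `w`, if `L`
has index `N`. -/
noncomputable def residualIndex (L : Set (List ℕ)) (k N : ℕ) (w : List ℕ) : ℕ :=
  (wordList k N).findIdx fun v => ∀ y ∈ wordList k (N * N), w ++ y ∈ L ↔ v ++ y ∈ L

open Classical in
/-- The minimal automaton of a language `L` of index `N`; its states are positions in
`wordList k N`, most of which are unreachable. -/
noncomputable def residualAutomaton (L : Set (List ℕ)) (k N : ℕ) : WordAutomaton ℕ where
  numStates := (wordList k N).length
  start := residualIndex L k N []
  trans := (List.range (wordList k N).length).flatMap fun q => (List.range k).map fun c =>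
    (q, c, residualIndex L k N ((wordList k N).getD q [] ++ [c]))
  accept := (List.range (wordList k N).length).filter fun q => (wordList k N).getD q [] ∈ L

theorem residualIndex_congr {u v : List ℕ} (huv : NerodeEquiv L u v) :
    residualIndex L k N u = residualIndex L k N v :=
  congrArg (List.findIdx · _) <| funext fun _ => decide_eq_decide.2 <|
    forall₂_congr fun y _ => iff_congr (huv y) Iff.rfl

theorem residualIndex_lt (h : HasIndex N fun x : Fin 1 → List ℕ => x 0 ∈ L) {w : List ℕ}
    (hw : ∀ c ∈ w, c < k) : residualIndex L k N w < (wordList k N).length := by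
  obtain ⟨v, hv, hwv⟩ := exists_mem_wordList_nerodeEquiv h hw
  exact List.findIdx_lt_length.2 ⟨v, hv, by simpa using fun y _ => hwv y⟩

theorem nerodeEquiv_getD_residualIndex (h : HasIndex N fun x : Fin 1 → List ℕ => x 0 ∈ L)
    (hL : ∀ w ∈ L, ∀ c ∈ w, c < k) {w : List ℕ} (hw : ∀ c ∈ w, c < k) :
    NerodeEquiv L w ((wordList k N).getD (residualIndex L k N w) []) := by
  classical
  have hlt := residualIndex_lt h hw
  rw [nerodeEquiv_iff h hL, List.getD_eq_getElem _ _ hlt]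
  exact of_decide_eq_true (List.findIdx_getElem (w := hlt))

theorem mem_runList_residualAutomaton_iff (h : HasIndex N fun x : Fin 1 → List ℕ => x 0 ∈ L)
    (hL : ∀ w ∈ L, ∀ c ∈ w, c < k) {w : List ℕ} (hw : ∀ c ∈ w, c < k) {r : ℕ} :
    r ∈ (residualAutomaton L k N).runList w ↔ r = residualIndex L k N w := by
  induction w using List.reverseRecOn generalizing r with
  | nil =>
    have hstart : (residualAutomaton L k N).start < (residualAutomaton L k N).numStates :=
      residualIndex_lt h hw
    rw [WordAutomaton.runList, List.foldl_nil, if_pos hstart]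
    exact List.mem_singleton
  | append_singleton w c ih =>
    have hwk : ∀ b ∈ w, b < k := fun b hb => hw b (List.mem_append_left _ hb)
    have hc : c < k := hw c (by simp)
    have hstep : residualIndex L k N
        ((wordList k N).getD (residualIndex L k N w) [] ++ [c]) = residualIndex L k N (w ++ [c]) :=
      residualIndex_congr fun y => by
        simpa using (nerodeEquiv_getD_residualIndex h hL hwk (c :: y)).symm
    rw [WordAutomaton.runList, List.foldl_append, List.foldl_cons, List.foldl_nil,
      ← WordAutomaton.runList, WordAutomaton.mem_stepList_iff]
    simp only [ih hwk, exists_eq_left]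
    simp only [residualAutomaton, List.mem_flatMap, List.mem_map, List.mem_range, Prod.mk.injEq]
    constructor
    · rintro ⟨-, _, -, _, -, rfl, rfl, rfl⟩
      exact hstep
    · rintro rfl
      exact ⟨residualIndex_lt h hw, _, residualIndex_lt h hwk, c, hc, rfl, rfl, hstep⟩

theorem wordSet_residualAutomaton (h : HasIndex N fun x : Fin 1 → List ℕ => x 0 ∈ L)
    (hL : ∀ w ∈ L, ∀ c ∈ w, c < k) : (residualAutomaton L k N).wordSet k = L := by
  have mem_iff : ∀ w, (∀ c ∈ w, c < k) →
      (w ∈ ((residualAutomaton L k N).toNFA id).accepts ↔ w ∈ L) := fun w hw => by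
    have hrep := nerodeEquiv_getD_residualIndex h hL hw []
    rw [List.append_nil, List.append_nil] at hrep
    simp only [WordAutomaton.mem_accepts_iff, mem_runList_residualAutomaton_iff h hL hw,
      exists_eq_left, hrep]
    simp [residualAutomaton, residualIndex_lt h hw]
  ext w
  exact ⟨fun ⟨hw, hacc⟩ => (mem_iff w hw).1 hacc, fun hw => ⟨hL w hw, (mem_iff w (hL w hw)).2 hw⟩⟩

end Residual

namespace UniformlyRegular

variable {γ : Type} [Primcodable γ] {m : ℕ} {k : γ → ℕ}

section MinimalAutomaton

variable {N : γ → ℕ} {L : γ → Set (List ℕ)}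

theorem primrec_residualIndex (h : UniformlyRegular fun a (x : Fin 1 → List ℕ) => x 0 ∈ L a)
    (hk : Primrec k) (hN : Primrec N) :
    Primrec fun p : γ × List ℕ => residualIndex (L p.1) (k p.1) (N p.1) p.2 := by
  classical
  refine Primrec.list_findIdx (primrec_wordList.comp (hk.comp Primrec.fst) (hN.comp Primrec.fst))
    (PrimrecPred.decide (primrecPred_forall_mem (p := fun (q : (γ × List ℕ) × List ℕ) y =>
      q.1.2 ++ y ∈ L q.1.1 ↔ q.2 ++ y ∈ L q.1.1) ?_ ?_))
  · have hk' := hk.comp (Primrec.fst.comp (Primrec.fst (α := γ × List ℕ) (β := List ℕ)))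
    have hN' := hN.comp (Primrec.fst.comp (Primrec.fst (α := γ × List ℕ) (β := List ℕ)))
    exact primrec_wordList.comp hk' (Primrec.nat_mul.comp hN' hN')
  · have ha := Primrec.fst.comp (Primrec.fst.comp
      (Primrec.fst (α := (γ × List ℕ) × List ℕ) (β := List ℕ)))
    exact primrecPred_iff
      (h.primrecPred_mem.comp (ha.pair (Primrec.list_append.comp
        (Primrec.snd.comp (Primrec.fst.comp Primrec.fst)) Primrec.snd)))
      (h.primrecPred_mem.comp (ha.pair (Primrec.list_append.comp
        (Primrec.snd.comp Primrec.fst) Primrec.snd)))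

theorem primrec_residualAutomaton (h : UniformlyRegular fun a (x : Fin 1 → List ℕ) => x 0 ∈ L a)
    (hk : Primrec k) (hN : Primrec N) :
    Primrec fun a => residualAutomaton (L a) (k a) (N a) := by
  classical
  have hwords := primrec_wordList.comp hk hN
  have hnum := Primrec.list_length.comp hwords
  have hstates := Primrec.list_range.comp hnum
  have hindex := h.primrec_residualIndex hk hN
  have hword : Primrec fun p : γ × ℕ => (wordList (k p.1) (N p.1)).getD p.2 [] :=
    (Primrec.list_getD []).comp (hwords.comp Primrec.fst) Primrec.snd
  refine (Primrec.of_equiv_symm (e := WordAutomaton.equivProd ℕ)).comp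
    (hnum.pair (.pair (hindex.comp (.pair .id (.const []))) (.pair ?_
      (primrec_filter hstates (h.primrecPred_mem.comp (.pair .fst hword))))))
  refine Primrec.list_flatMap hstates (Primrec.list_map
    (Primrec.list_range.comp (hk.comp Primrec.fst)) (Primrec.pair (Primrec.snd.comp Primrec.fst)
      (Primrec.pair Primrec.snd (hindex.comp (.pair (Primrec.fst.comp Primrec.fst) ?_)))))
  exact Primrec.list_concat.comp (hword.comp Primrec.fst) Primrec.snd

theorem exists_primrec_automaton
    (h : UniformlyRegular fun a (x : Fin 1 → List ℕ) => x 0 ∈ L a) (hk : Primrec k)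
    (hL : ∀ a, ∀ w ∈ L a, ∀ c ∈ w, c < k a) :
    ∃ A : γ → WordAutomaton ℕ, Primrec A ∧ ∀ a, (A a).wordSet (k a) = L a :=
  let ⟨N, hN, hi⟩ := h.exists_index
  ⟨fun a => residualAutomaton (L a) (k a) (N a), h.primrec_residualAutomaton hk hN,
    fun a => wordSet_residualAutomaton (hi a) (hL a)⟩

end MinimalAutomaton

section Base

theorem mem_wordSet {A : γ → WordAutomaton ℕ} (hA : Primrec A) (hk : Primrec k) (i : Fin m) :
    UniformlyRegular fun a (x : Fin m → List ℕ) => x i ∈ (A a).wordSet (k a) where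
  primrecPred := WordAutomaton.primrecPred_mem_wordSet (hA.comp Primrec.fst) (hk.comp Primrec.fst)
    (primrec_pi_iff.1 Primrec.snd i)
  exists_index := ⟨fun a => 4 * (2 * 2 ^ (A a).numStates),
    Primrec.nat_mul.comp (Primrec.const 4) (Primrec.nat_mul.comp (Primrec.const 2)
      (primrec_two_pow (WordAutomaton.primrec_numStates hA))),
    fun a => (A a).hasIndex_mem_wordSet (k a) i⟩

theorem eq (i j : Fin m) : UniformlyRegular fun (_ : γ) (x : Fin m → List ℕ) => x i = x j where
  primrecPred := Primrec.eq.comp (primrec_pi_iff.1 Primrec.snd i) (primrec_pi_iff.1 Primrec.snd j)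
  exists_index := ⟨fun _ => 8, Primrec.const 8, fun _ => HasIndex.eq i j⟩

variable {P : γ → AutomaticPresentation}

theorem wordLe (hP : Primrec P) (i j : Fin m) :
    UniformlyRegular fun a (x : Fin m → List ℕ) => (P a).wordLe (x i) (x j) where
  primrecPred := AutomaticPresentation.primrecPred_wordLe (hP.comp Primrec.fst)
    (primrec_pi_iff.1 Primrec.snd i) (primrec_pi_iff.1 Primrec.snd j)
  exists_index := ⟨fun a => 4 * 2 ^ (P a).relation.numStates,
    Primrec.nat_mul.comp (Primrec.const 4) (primrec_two_pow
      (WordAutomaton.primrec_numStates (AutomaticPresentation.primrec_relation hP))),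
    fun a => (P a).hasIndex_wordLe i j⟩

theorem wordLt (hP : Primrec P) (i j : Fin m) :
    UniformlyRegular fun a (x : Fin m → List ℕ) => (P a).wordLt (x i) (x j) :=
  (wordLe hP i j).and (eq i j).not

end Base

section Quantifiers

variable {n : ℕ} {R Q : γ → (Fin m → List ℕ) → Prop} {D : γ → Set (List ℕ)}

theorem imp (h : UniformlyRegular R) (h' : UniformlyRegular Q) :
    UniformlyRegular fun a x => R a x → Q a x := by
  simpa only [not_and, not_not] using (h.and h'.not).not

theorem forall_fin {S : Fin n → γ → (Fin m → List ℕ) → Prop}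
    (h : ∀ j, UniformlyRegular (S j)) : UniformlyRegular fun a x => ∀ j, S j a x := by
  induction n with
  | zero =>
    exact ⟨(Primrec.eq.comp (Primrec.const 0) (Primrec.const 0)).of_eq (by simp),
      fun _ => 1, Primrec.const 1, fun _ => ⟨fun _ _ => 0, by simp⟩⟩
  | succ n ih => simpa only [Fin.forall_fin_succ] using (h 0).and (ih fun j => h j.succ)

theorem forall_mem_update (h : UniformlyRegular R) (i : Fin m)
    (hD : UniformlyRegular fun a (x : Fin 1 → List ℕ) => x 0 ∈ D a) (hk : Primrec k)
    (hDk : ∀ a, ∀ w ∈ D a, ∀ c ∈ w, c < k a) :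
    UniformlyRegular fun a x => ∀ y ∈ D a, R a (Function.update x i y) := by
  simpa using (((hD.reindex fun _ => i).and h.not).exists_update hk fun a x hx =>
    hDk a (x i) hx.1).not

theorem primrecPred_forall_mem (h : UniformlyRegular R)
    (hD : UniformlyRegular fun a (x : Fin 1 → List ℕ) => x 0 ∈ D a) (hk : Primrec k)
    (hDk : ∀ a, ∀ w ∈ D a, ∀ c ∈ w, c < k a) :
    PrimrecPred fun a => ∀ x : Fin m → List ℕ, (∀ i, x i ∈ D a) → R a x := by
  simpa using (((forall_fin fun i => hD.reindex fun _ => i).and h.not).primrecPred_exists hk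
    fun a x hx i => hDk a (x i) (hx.1 i)).not

end Quantifiers

section Derivative

variable {D : γ → Set (List ℕ)} {lt : γ → List ℕ → List ℕ → Prop}
  (hlt : UniformlyRegular fun a (x : Fin 2 → List ℕ) => lt a (x 0) (x 1))
  (hD : UniformlyRegular fun a (x : Fin 1 → List ℕ) => x 0 ∈ D a) (hk : Primrec k)
  (hDk : ∀ a, ∀ w ∈ D a, ∀ c ∈ w, c < k a)

include hlt hD hk hDk

theorem infinite_between : UniformlyRegular fun a (x : Fin 2 → List ℕ) =>
    {z | z ∈ D a ∧ lt a (x 0) z ∧ lt a z (x 1)}.Infinite := by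
  have h : UniformlyRegular fun a (x : Fin 3 → List ℕ) =>
      x 2 ∈ D a ∧ lt a (x 0) (x 2) ∧ lt a (x 2) (x 1) :=
    (hD.reindex ![2]).and ((hlt.reindex ![0, 2]).and (hlt.reindex ![2, 1]))
  simpa using (h.infinite_update hk fun a x hx => hDk a _ hx.1).reindex ![0, 1, 0]

theorem mem_ordDeriv :
    UniformlyRegular fun a (x : Fin 1 → List ℕ) => x 0 ∈ ordDeriv (lt a) (D a) :=
  hD.and (by simpa using ((hlt.imp (infinite_between hlt hD hk hDk)).forall_mem_update
    0 hD hk hDk).reindex ![0, 0])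

theorem mem_derivTail :
    UniformlyRegular fun a (x : Fin 1 → List ℕ) => x 0 ∈ derivTail (lt a) (D a) :=
  hD.and (by simpa using (hlt.forall_mem_update 0 (mem_ordDeriv hlt hD hk hDk) hk
    fun a w hw => hDk a w hw.1).reindex ![0, 0])

theorem primrecPred_derivCofinite : PrimrecPred fun a => DerivCofinite (lt a) (D a) := by
  have h : UniformlyRegular fun a (x : Fin 2 → List ℕ) => x 0 ∈ ordDeriv (lt a) (D a) ∧
      ¬ lt a (x 1) (x 0) ∧ ¬ {z | z ∈ D a ∧ lt a (x 0) z ∧ lt a z (x 1)}.Infinite :=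
    ((mem_ordDeriv hlt hD hk hDk).reindex ![0]).and
      ((hlt.reindex ![1, 0]).not.and (infinite_between hlt hD hk hDk).not)
  have h_exists : UniformlyRegular fun a (x : Fin 1 → List ℕ) =>
      ∃ y ∈ ordDeriv (lt a) (D a),
        ¬ lt a (x 0) y ∧ {z | z ∈ D a ∧ lt a y z ∧ lt a z (x 0)}.Finite := by
    simpa using (h.exists_update (i := 0) hk fun a x hx => hDk a _ hx.1.1).reindex ![0, 0]
  exact (h_exists.primrecPred_forall_mem hD hk hDk).of_eq fun a => by
    simp [DerivCofinite, Fin.forall_fin_succ_pi]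

end Derivative

section Order

variable {D : γ → Set (List ℕ)} {le : γ → List ℕ → List ℕ → Prop}
  (hD : UniformlyRegular fun a (x : Fin 1 → List ℕ) => x 0 ∈ D a) (hk : Primrec k)
  (hDk : ∀ a, ∀ w ∈ D a, ∀ c ∈ w, c < k a)

include hD hk hDk

theorem primrecPred_nonempty : PrimrecPred fun a => (D a).Nonempty :=
  (hD.primrecPred_exists hk fun a x hx i => Subsingleton.elim i 0 ▸ hDk a (x 0) hx).of_eq fun _ =>
    ⟨fun ⟨x, hx⟩ => ⟨x 0, hx⟩, fun ⟨w, hw⟩ => ⟨fun _ => w, hw⟩⟩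

theorem primrecPred_subsingleton : PrimrecPred fun a => (D a).Subsingleton :=
  ((eq (m := 2) 0 1).primrecPred_forall_mem hD hk hDk).of_eq fun _ =>
    ⟨fun H u hu v hv => H ![u, v] (Fin.forall_fin_two.2 ⟨hu, hv⟩),
      fun H _ hx => H (hx 0) (hx 1)⟩

theorem primrecPred_linearOn
    (hle : UniformlyRegular fun a (x : Fin 2 → List ℕ) => le a (x 0) (x 1)) :
    PrimrecPred fun a => LinearOn (le a) (D a) := by
  have total : UniformlyRegular fun a (x : Fin 2 → List ℕ) =>
      le a (x 0) (x 1) ∨ le a (x 1) (x 0) := by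
    simpa [or_iff_not_imp_left] using hle.not.imp (hle.reindex ![1, 0])
  have antisymm := hle.imp ((hle.reindex ![1, 0]).imp (eq 0 1))
  have trans := (hle.reindex (n := 3) ![0, 1]).imp
    ((hle.reindex ![1, 2]).imp (hle.reindex ![0, 2]))
  refine ((total.primrecPred_forall_mem hD hk hDk).and
    ((antisymm.primrecPred_forall_mem hD hk hDk).and
      (trans.primrecPred_forall_mem hD hk hDk))).of_eq fun a => ?_
  refine and_congr ⟨fun H u hu v hv => ?_, fun H _ hx => H _ (hx 0) _ (hx 1)⟩
    (and_congr ⟨fun H u hu v hv => ?_, fun H _ hx => H _ (hx 0) _ (hx 1)⟩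
      ⟨fun H u hu v hv w hw => ?_, fun H _ hx => H _ (hx 0) _ (hx 1) _ (hx 2)⟩)
  · exact H ![u, v] (Fin.forall_fin_two.2 ⟨hu, hv⟩)
  · exact H ![u, v] (Fin.forall_fin_two.2 ⟨hu, hv⟩)
  · exact H ![u, v, w] (by simp [Fin.forall_fin_succ, hu, hv, hw])

end Order

end UniformlyRegular

namespace AutomaticPresentation

theorem lt_alphabetSize_of_mem_level (P : AutomaticPresentation) {j : ℕ} {w : List ℕ}
    (hw : w ∈ P.level j) : ∀ c ∈ w, c < P.alphabetSize :=
  (iterDeriv_subset _ _ j hw).1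

theorem exists_primrec_automaton_ordDeriv :
    ∃ f : AutomaticPresentation × WordAutomaton ℕ → WordAutomaton ℕ, Primrec f ∧
      ∀ q, (f q).wordSet q.1.alphabetSize =
        ordDeriv q.1.wordLt (q.2.wordSet q.1.alphabetSize) :=
  have hk := primrec_alphabetSize Primrec.fst
  UniformlyRegular.exists_primrec_automaton
    (UniformlyRegular.mem_ordDeriv (.wordLt Primrec.fst 0 1) (.mem_wordSet Primrec.snd hk 0) hk
      fun _ _ hw => hw.1) hk fun _ _ hw => hw.1.1

theorem exists_primrec_automaton_level :
    ∃ A : AutomaticPresentation × ℕ → WordAutomaton ℕ, Primrec A ∧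
      ∀ q, (A q).wordSet q.1.alphabetSize = q.1.level q.2 := by
  obtain ⟨f, hf, hf_deriv⟩ := exists_primrec_automaton_ordDeriv
  let A (P : AutomaticPresentation) (j : ℕ) : WordAutomaton ℕ :=
    Nat.rec P.domain (fun _ B => f (P, B)) j
  have hA : Primrec₂ A := Primrec.nat_rec (f := AutomaticPresentation.domain)
    (g := fun P q => f (P, q.2)) (primrec_domain Primrec.id)
    (hf.comp (Primrec.pair Primrec.fst (Primrec.snd.comp Primrec.snd)))
  have wordSet_A : ∀ P j, (A P j).wordSet P.alphabetSize = P.level j := fun P j => by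
    induction j with
    | zero => rfl
    | succ j ih => exact (hf_deriv (P, A P j)).trans (congrArg (ordDeriv P.wordLt) ih)
  exact ⟨fun q => A q.1 q.2, hA, fun q => wordSet_A q.1 q.2⟩

theorem uniformlyRegular_mem_level :
    UniformlyRegular fun (q : AutomaticPresentation × ℕ) (x : Fin 1 → List ℕ) =>
      x 0 ∈ q.1.level q.2 := by
  obtain ⟨A, hA, hA_level⟩ := exists_primrec_automaton_level
  simpa only [hA_level] using
    UniformlyRegular.mem_wordSet hA (primrec_alphabetSize Primrec.fst) (0 : Fin 1)

theorem exists_primrec_encard_derivTail_level :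
    ∃ f : AutomaticPresentation × ℕ → Option ℕ, Primrec f ∧
      ∀ q, (derivTail q.1.wordLt (q.1.level q.2)).encard = (f q).elim ⊤ (↑) :=
  have hk := primrec_alphabetSize Primrec.fst
  UniformlyRegular.exists_primrec_encard
    (UniformlyRegular.mem_derivTail (.wordLt Primrec.fst 0 1) uniformlyRegular_mem_level hk
      fun q _ => q.1.lt_alphabetSize_of_mem_level) hk
    fun q _ hw => q.1.lt_alphabetSize_of_mem_level hw.1

theorem uniformlyRegular_mem_domainSet :
    UniformlyRegular fun (P : AutomaticPresentation) (x : Fin 1 → List ℕ) => x 0 ∈ P.domainSet :=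
  .mem_wordSet (primrec_domain Primrec.id) (primrec_alphabetSize Primrec.id) 0

theorem primrecPred_isOrdinal : PrimrecPred IsOrdinal := by
  have linearOn : PrimrecPred fun P : AutomaticPresentation => LinearOn P.wordLe P.domainSet :=
    uniformlyRegular_mem_domainSet.primrecPred_linearOn (primrec_alphabetSize Primrec.id)
      (fun _ _ hw => hw.1) (.wordLe Primrec.id 0 1)
  have derivCofinite : PrimrecPred fun q : AutomaticPresentation × ℕ =>
      DerivCofinite q.1.wordLt (q.1.level q.2) :=
    UniformlyRegular.primrecPred_derivCofinite (.wordLt Primrec.fst 0 1)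
      uniformlyRegular_mem_level (primrec_alphabetSize Primrec.fst)
      fun q _ => q.1.lt_alphabetSize_of_mem_level
  have subsingleton : PrimrecPred fun q : AutomaticPresentation × ℕ =>
      (q.1.level q.2).Subsingleton :=
    uniformlyRegular_mem_level.primrecPred_subsingleton
      (primrec_alphabetSize Primrec.fst) fun q _ => q.1.lt_alphabetSize_of_mem_level
  have all_derivCofinite : PrimrecPred fun P : AutomaticPresentation =>
      ∀ j ∈ List.range P.rankBound, DerivCofinite P.wordLt (P.level j) :=
    primrecPred_forall_mem (p := fun P j => DerivCofinite P.wordLt (P.level j))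
      (Primrec.list_range.comp primrec_rankBound) derivCofinite
  refine (linearOn.and (all_derivCofinite.and
    (subsingleton.comp (.pair .id primrec_rankBound)))).of_eq fun P => ?_
  simp only [List.mem_range, isOrdinal_iff]
  rfl

theorem primrecPred_encard_derivTail_level_eq :
    PrimrecPred fun q : (AutomaticPresentation × AutomaticPresentation) × ℕ =>
      (derivTail q.1.1.wordLt (q.1.1.level q.2)).encard =
        (derivTail q.1.2.wordLt (q.1.2.level q.2)).encard := by
  obtain ⟨tailSize, primrec_tailSize, encard_tail⟩ := exists_primrec_encard_derivTail_level
  have same_tailSize : PrimrecPred fun q : (AutomaticPresentation × AutomaticPresentation) × ℕ =>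
      tailSize (q.1.1, q.2) = tailSize (q.1.2, q.2) :=
    Primrec.eq.comp (primrec_tailSize.comp (.pair (Primrec.fst.comp Primrec.fst) Primrec.snd))
      (primrec_tailSize.comp (.pair (Primrec.snd.comp Primrec.fst) Primrec.snd))
  refine same_tailSize.of_eq fun q => ?_
  rw [encard_tail (q.1.1, q.2), encard_tail (q.1.2, q.2)]
  cases tailSize (q.1.1, q.2) <;> cases tailSize (q.1.2, q.2) <;> simp

theorem primrecPred_nonempty_domainSet :
    PrimrecPred fun P : AutomaticPresentation => P.domainSet.Nonempty :=
  uniformlyRegular_mem_domainSet.primrecPred_nonempty (primrec_alphabetSize Primrec.id)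
    fun _ _ hw => hw.1

end AutomaticPresentation

open AutomaticPresentation

theorem mainTheorem12_general :
    PrimrecPred fun p : AutomaticPresentation × AutomaticPresentation =>
      p.1.IsOrdinal ∧ p.2.IsOrdinal ∧ p.1.Isomorphic p.2 := by
  have nonempty := primrecPred_nonempty_domainSet
  have bound : Primrec fun p : AutomaticPresentation × AutomaticPresentation =>
      p.1.rankBound + p.2.rankBound :=
    Primrec.nat_add.comp (primrec_rankBound.comp Primrec.fst) (primrec_rankBound.comp Primrec.snd)
  have same_tails : PrimrecPred fun p : AutomaticPresentation × AutomaticPresentation =>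
      ∀ j ∈ List.range (p.1.rankBound + p.2.rankBound),
        (derivTail p.1.wordLt (p.1.level j)).encard = (derivTail p.2.wordLt (p.2.level j)).encard :=
    primrecPred_forall_mem (p := fun p j => (derivTail p.1.wordLt (p.1.level j)).encard =
      (derivTail p.2.wordLt (p.2.level j)).encard)
      (Primrec.list_range.comp bound) primrecPred_encard_derivTail_level_eq
  refine ((primrecPred_isOrdinal.comp Primrec.fst).and ((primrecPred_isOrdinal.comp Primrec.snd).and
    ((primrecPred_iff (nonempty.comp Primrec.fst) (nonempty.comp Primrec.snd)).and
      same_tails))).of_eq fun p => and_congr_right fun hP => and_congr_right fun hQ => ?_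
  simp only [List.mem_range, hP.isomorphic_iff hQ]

theorem mainTheorem12 :
    ComputablePred fun p : AutomaticPresentation × AutomaticPresentation =>
      p.1.IsOrdinal ∧ p.2.IsOrdinal ∧ p.1.Isomorphic p.2 := by
  exact mainTheorem12_general.computablePred
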